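/- Let $\mathcal X$ be a finite or countably infinite set, $K$ an irreducible Markov kernel on $\mathcal X$ (so $\sum_y K(x,y)=1$ for all $x$) and $\pi$ a probability measure on $\mathcal X$ that is reversible for $K$: $K(x,y)\pi(x)=K(y,x)\pi(y)$ for all $x,y$. Let $d$ be the graph distance of $K$, that is, $d(x,y)$ is the least $n\ge 0$ for which there are $x_0=x,x_1,\dots,x_n=y$ with $K(x_i,x_{i+1})>0$ for all $i<n$. For probability measures $\nu,\mu$ on $\mathcal X$ define the weak transport cost $$\widetilde W_2(\nu|\mu)^2:=\inf_{Y\sim\nu,\ X\sim\mu}\mathbb E\Big[\big(\mathbb E[d(Y,X)\,|\,Y]\big)^2\Big]=\inf_{p}\ \sum_{y}\nu(y)\Big(\sum_x d(y,x)\,p_y(x)\Big)^2 ,$$ the first infimum being over all couplings of $\nu$ and $\mu$ and the second over all Markov kernels $p$ on $\mathcal X$ with $\sum_y\nu(y)p_y(x)=\mu(x)$ for all $x$. For $f:\mathcal X\to[0,\infty)$ with $\sum_x f(x)\pi(x)=1$ put $$\mathcal I_\pi(f):=4\int\Gamma(\sqrt f)\,d\pi=2\sum_{x,y}\big(\sqrt{f(y)}-\sqrt{f(x)}\big)^2K(x,y)\pi(x),\qquad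 \mathrm{Ent}_\pi(f):=\sum_x f(x)\log f(x)\,\pi(x)\in[0,\infty].$$ Let $C>0$. Suppose that $\pi$ satisfies the weak transport-information inequality $\widetilde T_2^+I(C)$: $$\widetilde W_2(f\pi|\pi)^2\le\frac1{C^2}\,\mathcal I_\pi(f)\qquad\text{for every probability measure } f\pi .$$ Then $\pi$ satisfies the weak transport-entropy inequality $\widetilde T_2^+H(C)$: $$\widetilde W_2(f\pi|\pi)^2\le\frac2C\,\mathrm{Ent}_\pi(f)\qquad\text{for every probability measure } f\pi .$$ -/

import Mathlib

open scoped ENNReal NNReal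

noncomputable section

namespace WeakTransport

variable {X : Type*}

/-- There is a chain of `n` steps `x = c 0, c 1, …, c n = y` all of whose transitions have positive
probability. -/
def HasPath (K : X → PMF X) (x y : X) (n : ℕ) : Prop :=
  ∃ c : ℕ → X, c 0 = x ∧ c n = y ∧ ∀ i < n, 0 < K (c i) (c (i + 1))

/-- The Markov kernel `K` (`K x y` is the probability of a jump from `x` to `y`, and
`∑ y, K x y = 1` because `K x` is a `PMF`) is irreducible. -/
def IsIrreducible (K : X → PMF X) : Prop :=
  ∀ x y, ∃ n, HasPath K x y n

/-- Detailed balance: `π x * K x y = π y * K y x`. -/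
def IsReversible (K : X → PMF X) (π : PMF X) : Prop :=
  ∀ x y, π x * K x y = π y * K y x

/-- The graph distance of the kernel: the least length of a chain from `x` to `y`
(such a chain exists when `K` is irreducible). -/
def graphDist (K : X → PMF X) (x y : X) : ℕ :=
  sInf {n : ℕ | HasPath K x y n}

/-- `Γ(u)(x) = 1/2 * ∑ y, (u y - u x)^2 * K x y`, a sum of nonnegative terms. -/
def carreDuChamp (K : X → PMF X) (u : X → ℝ) (x : X) : ℝ≥0∞ :=
  (1 / 2) * ∑' y, ENNReal.ofReal ((u y - u x) ^ 2) * K x y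

/-- The Fisher information `I_π(f) = 4 ∫ Γ(√f) dπ`. -/
def fisherInfo (K : X → PMF X) (π : PMF X) (f : X → ℝ≥0) : ℝ≥0∞ :=
  4 * ∑' x, carreDuChamp K (fun z => Real.sqrt (f z)) x * π x

open Classical in
/-- The relative entropy `∑ f log f π - (∑ f π) log (∑ f π)`. The function `t log t` is bounded
below and `π` has mass one, so the first sum always has a value in `(-∞, ∞]`, and it is `∞` exactly
when the summability below fails. The real number under `ENNReal.ofReal` is nonnegative by Jensen's
inequality. -/
def relEntropy (π : PMF X) (f : X → ℝ≥0) : ℝ≥0∞ :=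
  if Summable (fun x => (f x : ℝ) * Real.log (f x) * (π x).toReal) then
    ENNReal.ofReal ((∑' x, (f x : ℝ) * Real.log (f x) * (π x).toReal)
      - (∑' x, (f x : ℝ) * (π x).toReal) * Real.log (∑' x, (f x : ℝ) * (π x).toReal))
  else ⊤

/-- Marton's weak transport cost `W̃₂(ν|μ)²` for the distance `d`: the infimum, over couplings
`(Y, X)` of `ν` and `μ`, of `E[(E[d(Y, X) | Y])²]`. A coupling is given by its disintegration
`ν(dy) p_y(dx)`: the kernel `p` is a conditional law of `X` given `Y`, and the second marginal being
`μ` means `ν.bind p = μ`.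
This cost is dual to `sup_g {∫ Q g dν - ∫ g dμ}` with
`Q g (y) = inf_p {∫ g dp + (∫ d(y, x) p(dx))²}`. -/
def weakCost (d : X → X → ℕ) (ν μ : PMF X) : ℝ≥0∞ :=
  ⨅ (p : X → PMF X) (_ : ν.bind p = μ), ∑' y, ν y * (∑' x, (d y x : ℝ≥0∞) * p y x) ^ 2

/-- The weak transport-information inequality `T̃₂⁺I(C)`: for all probability measures `ν = f π`,
`W̃₂(f π|π)² ≤ I_π(f) / C²`. -/
def WeakTransportInformation (K : X → PMF X) (π : PMF X) (C : ℝ) : Prop :=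
  ∀ (f : X → ℝ≥0) (ν : PMF X), (∀ x, ν x = f x * π x) →
    weakCost (graphDist K) ν π ≤ ENNReal.ofReal (1 / C ^ 2) * fisherInfo K π f

/-- The weak transport-entropy inequality `T̃₂⁺H(C)`: for all probability measures `ν = f π`,
`W̃₂(f π|π)² ≤ (2 / C) Ent_π(f)`. -/
def WeakTransportEntropy (K : X → PMF X) (π : PMF X) (C : ℝ) : Prop :=
  ∀ (f : X → ℝ≥0) (ν : PMF X), (∀ x, ν x = f x * π x) →
    weakCost (graphDist K) ν π ≤ ENNReal.ofReal (2 / C) * relEntropy π f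

end WeakTransport

end

open scoped ENNReal NNReal

noncomputable section

namespace WeakTransport

variable {X : Type*}

/-! The argument of Otto and Villani runs along the heat flow of `K`, in discrete time. Write `W`,
`E`, `I` for the squared weak cost to `π`, the entropy and the Fisher information. Replacing `f` by
`(1 - s) f + s K f` lowers `E` by at least `s I - O(s²)` and lowers `W` by at most `(2 s / C) I +
O(s²)`. Steps are iterated until `I ≤ η`, which happens within time about `E / η` since `E` stays
nonnegative. There the hypothesis gives `W ≤ η / C²`, so convergence to equilibrium is never needed.
Letting `s → 0` and then `η → 0` gives `W ≤ (2 / C) E` (`le_entropy_of_step`).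

The bound on the loss of `W` is the heart (`weakCost_le_weakCost_step`). Mass is carried from `ν` to
the next measure only along edges where `f` decreases, at rate `s (f x - f y)₊ / f x`. A jump
changes distances by at most one, so by Cauchy–Schwarz it costs `2 r(x) a(x)` to first order, where
`r(x)` is the total rate and `a(x)` the mean distance transported from `x`. The remainder `2 s²`
does not involve `a`, so unbounded distances do no harm. Now `f x - f y ≤ 2 √(f x) (√(f x) - √(f
y))` on these edges, and Young's inequality bounds the first-order term by `s (C ∑ ν a² + I / C)`.
The hypothesis bounds `∑ ν a²` by `I / C²` up to `O(s)`.

The entropy remainder requires `f` to lie between positive constants, a condition the flow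
preserves. General densities are reached by clipping, with lower semicontinuity of the weak cost. -/

/-! ### Weak transport cost under a lazy move. -/

theorem sq_tsum_mul_le (w f : X → ℝ≥0∞) :
    (∑' x, w x * f x) ^ 2 ≤ (∑' x, w x) * ∑' x, w x * f x ^ 2 := by
  have key : ∀ s : Finset X,
      (∑ x ∈ s, w x * f x) ^ 2 ≤ (∑' x, w x) * ∑' x, w x * f x ^ 2 := by
    intro s
    have h := ENNReal.inner_le_weight_mul_Lp_of_nonneg s (p := 2) (by norm_num) w f
    have h2 : (∑ x ∈ s, w x * f x) ^ 2 ≤ (∑ x ∈ s, w x) * ∑ x ∈ s, w x * f x ^ 2 := by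
      calc (∑ x ∈ s, w x * f x) ^ 2
          ≤ ((∑ x ∈ s, w x) ^ (1 - (2 : ℝ)⁻¹) * (∑ x ∈ s, w x * f x ^ (2 : ℝ)) ^ (2 : ℝ)⁻¹) ^ 2 :=
            pow_le_pow_left' h 2
        _ = (∑ x ∈ s, w x) * ∑ x ∈ s, w x * f x ^ 2 := by
            rw [mul_pow, ← ENNReal.rpow_natCast, ← ENNReal.rpow_natCast, ← ENNReal.rpow_mul,
              ← ENNReal.rpow_mul]
            norm_num
    exact h2.trans (mul_le_mul' (ENNReal.sum_le_tsum s) (ENNReal.sum_le_tsum s))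
  have ht : Filter.Tendsto (fun s : Finset X => (∑ x ∈ s, w x * f x) ^ 2) Filter.atTop
      (nhds ((∑' x, w x * f x) ^ 2)) :=
    ((ENNReal.continuous_pow 2).tendsto _).comp ENNReal.summable.hasSum
  exact le_of_tendsto' ht key

/-- The kernel which moves along the sub-probability kernel `r` and otherwise stays put. -/
def lazyKernel (r : X → X → ℝ≥0∞) (hr : ∀ x, ∑' y, r x y ≤ 1) (x : X) : PMF X := by
  classical
  exact ⟨fun y => r x y + if y = x then 1 - ∑' z, r x z else 0, by
    have : ∑' y, (r x y + if y = x then 1 - ∑' z, r x z else 0) = 1 := by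
      rw [ENNReal.tsum_add, tsum_ite_eq x (fun _ => 1 - ∑' z, r x z), add_tsub_cancel_of_le (hr x)]
    exact (Summable.hasSum_iff ENNReal.summable).2 this⟩

theorem lazyKernel_apply [DecidableEq X] (r : X → X → ℝ≥0∞) (hr : ∀ x, ∑' y, r x y ≤ 1) (x y : X) :
    lazyKernel r hr x y = r x y + if y = x then 1 - ∑' z, r x z else 0 := by
  unfold lazyKernel
  simp only [DFunLike.coe]
  congr

theorem tsum_lazyKernel_mul (r : X → X → ℝ≥0∞) (hr : ∀ x, ∑' y, r x y ≤ 1) (g : X → ℝ≥0∞)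
    (x : X) : ∑' y, lazyKernel r hr x y * g y
      = ∑' y, r x y * g y + (1 - ∑' y, r x y) * g x := by
  classical
  simp only [lazyKernel_apply, add_mul, ite_mul, zero_mul]
  rw [ENNReal.tsum_add, tsum_ite_eq x (fun y => (1 - ∑' z, r x z) * g y)]

/-- Pushing a PMF through a lazy kernel, tested at a point: inflow plus what stays. -/
theorem bind_lazyKernel_apply (r : X → X → ℝ≥0∞) (hr : ∀ x, ∑' y, r x y ≤ 1) (ν : PMF X) (y : X) :
    ν.bind (lazyKernel r hr) y = ∑' x, ν x * r x y + ν y * (1 - ∑' z, r y z) := by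
  classical
  simp only [PMF.bind_apply, lazyKernel_apply, mul_add, mul_ite, mul_zero]
  rw [ENNReal.tsum_add]
  congr 1
  rw [tsum_eq_single y]
  · simp
  · intro x hx; simp [hx.symm]

theorem tsum_bind_mul (ν : PMF X) (R : X → PMF X) (g : X → ℝ≥0∞) :
    ∑' y, ν.bind R y * g y = ∑' x, ν x * ∑' y, R x y * g y := by
  simp only [PMF.bind_apply, ← ENNReal.tsum_mul_right, ← ENNReal.tsum_mul_left]
  rw [ENNReal.tsum_comm]
  simp only [mul_assoc]

/-- Here `ρ` is the jump probability from a point, and `u`, `V` are the first and second moments of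
`a` after a jump. With `u = ρ m` and `δ = m - a`, right minus left is `ρ δ² + 2 s² - ρ² (1 + δ)²`.
It is nonnegative because `(1 + δ)² ≤ 2 + 2 δ²` and `ρ ≤ s ≤ 1/2`. -/
theorem sq_lazy_mean_le {a u V ρ : ℝ≥0∞} {s : ℝ≥0} (hu : u ^ 2 ≤ ρ * V) (hρ : ρ ≤ s)
    (hs : s ≤ 1 / 2) :
    ((1 - ρ) * a + (ρ + u)) ^ 2 ≤ (V + (1 - ρ) * a ^ 2) + 2 * (ρ * a) + 2 * (s : ℝ≥0∞) ^ 2 := by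
  have hρt : ρ ≠ ⊤ := ne_top_of_le_ne_top ENNReal.coe_ne_top hρ
  have hs1 : (s : ℝ≥0∞) < 1 := by
    have : s < 1 := lt_of_le_of_lt hs (by rw [← NNReal.coe_lt_coe]; norm_num)
    exact_mod_cast this
  have hρ1 : (1 : ℝ≥0∞) - ρ ≠ 0 := by
    rw [Ne, tsub_eq_zero_iff_le, not_le]; exact lt_of_le_of_lt hρ hs1
  by_cases hV : V = ⊤
  · simp [hV]
  by_cases ha : a = ⊤
  · simp [ha, hρ1]
  have hut : u ≠ ⊤ := by
    intro h
    rw [h] at hu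
    exact (ENNReal.mul_ne_top hρt hV) (top_le_iff.1 (by simpa using hu))
  lift ρ to ℝ≥0 using hρt
  lift V to ℝ≥0 using hV
  lift a to ℝ≥0 using ha
  lift u to ℝ≥0 using hut
  have hu' : u ^ 2 ≤ ρ * V := by exact_mod_cast hu
  have hρ' : ρ ≤ s := by exact_mod_cast hρ
  have hρ1' : ρ ≤ 1 := by exact_mod_cast (hρ.trans hs1.le)
  suffices h : ((1 - ρ) * a + (ρ + u)) ^ 2 ≤ (V + (1 - ρ) * a ^ 2) + 2 * (ρ * a) + 2 * s ^ 2 by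
    exact_mod_cast h
  rw [← NNReal.coe_le_coe] at *
  push_cast [NNReal.coe_sub (show ρ ≤ 1 from hρ1')] at *
  have hr0 := ρ.2
  have ha0 := a.2
  have hu0 := u.2
  have hV0 := V.2
  simp only [NNReal.val_eq_coe] at *
  generalize (ρ : ℝ) = ρ at *
  generalize (a : ℝ) = a at *
  generalize (u : ℝ) = u at *
  generalize (V : ℝ) = V at *
  generalize (s : ℝ) = s at *
  rcases hr0.eq_or_lt with h0 | h0
  · subst h0
    have : u = 0 := by nlinarith
    subst this
    nlinarith [sq_nonneg s]
  · obtain ⟨m, rfl⟩ : ∃ m, u = ρ * m := ⟨u / ρ, by field_simp⟩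
    have hVm : ρ * m ^ 2 ≤ V := by
      have : ρ * (ρ * m ^ 2) ≤ ρ * V := by nlinarith
      exact le_of_mul_le_mul_left this h0
    have h1 : ρ * (ρ * (m - a) ^ 2) ≤ (1 / 2) * (ρ * (m - a) ^ 2) :=
      mul_le_mul_of_nonneg_right (by linarith) (by positivity)
    have h2 : ρ ^ 2 ≤ s ^ 2 := pow_le_pow_left₀ h0.le hρ' 2
    have h3 : 0 ≤ ρ ^ 2 * (1 - (m - a)) ^ 2 := by positivity
    nlinarith

/-- A first order expansion of the weak transport cost along a lazy move: from a transport of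
`ν.bind R` to `μ` one gets a transport of `ν` to `μ` by first moving along `R`. -/
theorem weakCost_le_of_lazyKernel (d : X → X → ℕ) (μ ν : PMF X) (r : X → X → ℝ≥0∞)
    (hr : ∀ x, ∑' y, r x y ≤ 1) {s : ℝ≥0} (hrs : ∀ x, ∑' y, r x y ≤ s) (hs : s ≤ 1 / 2)
    (hd : ∀ x y z, r x y ≠ 0 → d x z ≤ d y z + 1) (p : X → PMF X)
    (hp : (ν.bind (lazyKernel r hr)).bind p = μ) :
    weakCost d ν μ ≤
      ∑' y, ν.bind (lazyKernel r hr) y * (∑' z, (d y z : ℝ≥0∞) * p y z) ^ 2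
      + 2 * ∑' x, ν x * ((∑' y, r x y) * ∑' z, (d x z : ℝ≥0∞) * p x z) + 2 * (s : ℝ≥0∞) ^ 2 := by
  set a : X → ℝ≥0∞ := fun x => ∑' z, (d x z : ℝ≥0∞) * p x z with ha
  have hmean : ∀ x, ∑' z, (d x z : ℝ≥0∞) * (lazyKernel r hr x).bind p z
      ≤ (1 - ∑' y, r x y) * a x + (∑' y, r x y + ∑' y, r x y * a y) := by
    intro x
    have h1 : ∑' z, (d x z : ℝ≥0∞) * (lazyKernel r hr x).bind p z
        = ∑' y, lazyKernel r hr x y * ∑' z, (d x z : ℝ≥0∞) * p y z := by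
      simp only [mul_comm (_ : ℝ≥0∞) ((lazyKernel r hr x).bind p _)]
      rw [tsum_bind_mul]
      simp only [mul_comm]
    rw [h1, tsum_lazyKernel_mul, add_comm]
    gcongr
    rw [← ENNReal.tsum_add]
    refine ENNReal.tsum_le_tsum fun y => ?_
    by_cases hxy : r x y = 0
    · simp [hxy]
    calc r x y * ∑' z, (d x z : ℝ≥0∞) * p y z
        ≤ r x y * ∑' z, (p y z + (d y z : ℝ≥0∞) * p y z) := by
          gcongr with z
          calc (d x z : ℝ≥0∞) * p y z ≤ ((d y z + 1 : ℕ) : ℝ≥0∞) * p y z := by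
                gcongr; exact hd x y z hxy
            _ = _ := by push_cast; ring
      _ = r x y + r x y * a y := by
          rw [ENNReal.tsum_add, (p y).tsum_coe, mul_add, mul_one]
  calc weakCost d ν μ
      ≤ ∑' x, ν x * (∑' z, (d x z : ℝ≥0∞) * (lazyKernel r hr x).bind p z) ^ 2 :=
        iInf₂_le (fun x => (lazyKernel r hr x).bind p) (by rw [← hp, PMF.bind_bind])
    _ ≤ ∑' x, ν x * ((∑' y, r x y * a y ^ 2 + (1 - ∑' y, r x y) * a x ^ 2)
          + 2 * ((∑' y, r x y) * a x) + 2 * (s : ℝ≥0∞) ^ 2) := by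
        gcongr with x
        exact (pow_le_pow_left' (hmean x) 2).trans
          (sq_lazy_mean_le (sq_tsum_mul_le _ _) (hrs x) hs)
    _ = _ := by
        simp only [mul_add]
        rw [ENNReal.tsum_add, ENNReal.tsum_add, ENNReal.tsum_mul_right, ν.tsum_coe, one_mul,
          tsum_bind_mul]
        simp only [tsum_lazyKernel_mul, mul_add]
        congr 2
        rw [← ENNReal.tsum_mul_left]
        congr 1; ext x; ring

/-! ### Graph distance and Fisher information. -/

theorem HasPath.cons {K : X → PMF X} {x y z : X} {n : ℕ} (hxy : 0 < K x y)
    (h : HasPath K y z n) : HasPath K x z (n + 1) := by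
  obtain ⟨c, h0, hn, hc⟩ := h
  refine ⟨fun i => Nat.casesOn i x c, rfl, hn, fun i hi => ?_⟩
  cases i with
  | zero => simpa [h0] using hxy
  | succ i => exact hc i (by omega)

/-- An edge is prepended to a shortest chain. Irreducibility ensures that one exists; otherwise
`sInf ∅ = 0` would be a false distance. -/
theorem graphDist_le_succ {K : X → PMF X} (hirr : IsIrreducible K) {x y : X} (z : X)
    (hxy : 0 < K x y) : graphDist K x z ≤ graphDist K y z + 1 :=
  Nat.sInf_le (HasPath.cons hxy (Nat.sInf_mem (hirr y z)))

theorem tsum_edge_swap {K : X → PMF X} {π : PMF X} (hrev : IsReversible K π)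
    (g : X → X → ℝ≥0∞) :
    ∑' x, ∑' y, g x y * (π x * K x y) = ∑' x, ∑' y, g y x * (π x * K x y) := by
  rw [ENNReal.tsum_comm]
  refine tsum_congr fun x => tsum_congr fun y => ?_
  rw [hrev]

/-- The Fisher information as a sum over oriented edges. -/
theorem fisherInfo_eq {K : X → PMF X} {π : PMF X} (f : X → ℝ≥0) :
    fisherInfo K π f = 2 * ∑' x, ∑' y,
      ENNReal.ofReal ((Real.sqrt (f y) - Real.sqrt (f x)) ^ 2) * (π x * K x y) := by
  unfold fisherInfo carreDuChamp
  rw [← ENNReal.tsum_mul_left, ← ENNReal.tsum_mul_left]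
  refine tsum_congr fun x => ?_
  have h4 : (4 : ℝ≥0∞) * (1 / 2) = 2 := by
    rw [one_div, show (4 : ℝ≥0∞) = 2 * 2 by norm_num, mul_assoc,
      ENNReal.mul_inv_cancel (by norm_num) (by norm_num), mul_one]
  calc (4 : ℝ≥0∞) * (1 / 2 * (∑' y, ENNReal.ofReal ((Real.sqrt (f y) - Real.sqrt (f x)) ^ 2) * K x y)
          * π x)
      = 4 * (1 / 2) * ((∑' y, ENNReal.ofReal ((Real.sqrt (f y) - Real.sqrt (f x)) ^ 2) * K x y)
          * π x) := by ring
    _ = _ := by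
      rw [h4, ← ENNReal.tsum_mul_right]
      congr 1
      refine tsum_congr fun y => by ring

/-- Only the edges along which `√f` decreases contribute, by symmetry. -/
theorem fisherInfo_eq_decreasing {K : X → PMF X} {π : PMF X} (hrev : IsReversible K π)
    (f : X → ℝ≥0) :
    fisherInfo K π f = 4 * ∑' x, ∑' y,
      (((NNReal.sqrt (f x) - NNReal.sqrt (f y)) ^ 2 : ℝ≥0) : ℝ≥0∞) * (π x * K x y) := by
  have h : ∀ x y, ENNReal.ofReal ((Real.sqrt (f y) - Real.sqrt (f x)) ^ 2)
      = (((NNReal.sqrt (f x) - NNReal.sqrt (f y)) ^ 2 : ℝ≥0) : ℝ≥0∞)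
        + (((NNReal.sqrt (f y) - NNReal.sqrt (f x)) ^ 2 : ℝ≥0) : ℝ≥0∞) := by
    intro x y
    rw [← ENNReal.coe_add, ← ENNReal.ofReal_coe_nnreal]
    congr 1
    rcases le_total (NNReal.sqrt (f x)) (NNReal.sqrt (f y)) with h | h
    · rw [tsub_eq_zero_of_le h]
      push_cast [NNReal.coe_sub h]
      ring
    · rw [tsub_eq_zero_of_le h]
      push_cast [NNReal.coe_sub h]
      ring
  rw [fisherInfo_eq]
  simp only [h, add_mul, ENNReal.tsum_add]
  rw [tsum_edge_swap hrev
    (fun x y => (((NNReal.sqrt (f y) - NNReal.sqrt (f x)) ^ 2 : ℝ≥0) : ℝ≥0∞))]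
  ring

theorem tsum_edge_left {K : X → PMF X} {π : PMF X} (g : X → ℝ≥0∞) :
    ∑' x, ∑' y, g x * (π x * K x y) = ∑' x, g x * π x := by
  refine tsum_congr fun x => ?_
  rw [ENNReal.tsum_mul_left, ENNReal.tsum_mul_left, (K x).tsum_coe, mul_one]

/-- On a decreasing edge `(√(f x) - √(f y))² ≤ f x`. Finiteness makes every cost finite under the
hypothesis, and the bound 4 makes the error of a step uniform. -/
theorem fisherInfo_le {K : X → PMF X} {π : PMF X} (hrev : IsReversible K π) (f : X → ℝ≥0)
    (ν : PMF X) (hν : ∀ x, ν x = f x * π x) : fisherInfo K π f ≤ 4 := by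
  rw [fisherInfo_eq_decreasing hrev]
  calc _ ≤ 4 * ∑' x, ∑' y, (f x : ℝ≥0∞) * (π x * K x y) := by
        gcongr with x y
        calc (NNReal.sqrt (f x) - NNReal.sqrt (f y)) ^ 2 ≤ NNReal.sqrt (f x) ^ 2 := by
              gcongr; exact tsub_le_self
          _ = f x := NNReal.sq_sqrt _
    _ = 4 := by
      rw [tsum_edge_left]
      simp only [← hν, ν.tsum_coe, mul_one]

/-! ### One step of the heat flow and the transport realising it. -/

/-- The density of `(1 - s) ν + s ν K` with respect to `π`, when `ν = f π`. -/
def stepDensity (K : X → PMF X) (s : ℝ≥0) (f : X → ℝ≥0) (x : X) : ℝ≥0 :=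
  (1 - s) * f x + s * (∑' y, (f y : ℝ≥0∞) * K x y).toNNReal

/-- The rate at which mass is moved from `x` to `y` in order to go from `f π` to
`(1 - s) f π + s K(f) π`: only moves which decrease the density are used. -/
def moveRate (K : X → PMF X) (s : ℝ≥0) (f : X → ℝ≥0) (x y : X) : ℝ≥0∞ :=
  ((s * ((f x - f y) / f x) : ℝ≥0) : ℝ≥0∞) * K x y

theorem tsum_moveRate_le (K : X → PMF X) (s : ℝ≥0) (f : X → ℝ≥0) (x : X) :
    ∑' y, moveRate K s f x y ≤ s := by
  calc ∑' y, moveRate K s f x y ≤ ∑' y, (s : ℝ≥0∞) * K x y := by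
        unfold moveRate
        gcongr with y
        calc s * ((f x - f y) / f x) ≤ s * 1 := by
              gcongr
              exact div_le_one_of_le₀ tsub_le_self (zero_le)
          _ = s := mul_one s
    _ = s := by rw [ENNReal.tsum_mul_left, (K x).tsum_coe, mul_one]

theorem density_mul_moveRate {K : X → PMF X} (s : ℝ≥0) {f : X → ℝ≥0} (hf : ∀ x, 0 < f x)
    (x y : X) : (f x : ℝ≥0∞) * moveRate K s f x y = ((s * (f x - f y) : ℝ≥0) : ℝ≥0∞) * K x y := by
  unfold moveRate
  rw [← mul_assoc, ← ENNReal.coe_mul]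
  congr 2
  have := (hf x).ne'
  field_simp

theorem tsum_kernel_mul_le {K : X → PMF X} {f : X → ℝ≥0} {M : ℝ≥0} (hM : ∀ x, f x ≤ M) (x : X) :
    ∑' y, (f y : ℝ≥0∞) * K x y ≤ M := by
  calc ∑' y, (f y : ℝ≥0∞) * K x y ≤ ∑' y, (M : ℝ≥0∞) * K x y := by
        gcongr with y; exact hM y
    _ = M := by rw [ENNReal.tsum_mul_left, (K x).tsum_coe, mul_one]

theorem coe_stepDensity {K : X → PMF X} {s : ℝ≥0} {f : X → ℝ≥0} {M : ℝ≥0} (hM : ∀ x, f x ≤ M)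
    (x : X) : (stepDensity K s f x : ℝ≥0∞)
      = ((1 - s : ℝ≥0) : ℝ≥0∞) * f x + s * ∑' y, (f y : ℝ≥0∞) * K x y := by
  unfold stepDensity
  push_cast
  rw [ENNReal.coe_toNNReal (ne_top_of_le_ne_top ENNReal.coe_ne_top (tsum_kernel_mul_le hM x))]

theorem stepDensity_le {K : X → PMF X} {s : ℝ≥0} (hs : s ≤ 1) {f : X → ℝ≥0} {M : ℝ≥0}
    (hM : ∀ x, f x ≤ M) (x : X) : stepDensity K s f x ≤ M := by
  have : (stepDensity K s f x : ℝ≥0∞) ≤ ((1 - s : ℝ≥0) : ℝ≥0∞) * M + s * M := by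
    rw [coe_stepDensity hM]
    gcongr
    · exact hM x
    · exact tsum_kernel_mul_le hM x
  rw [← add_mul, ← ENNReal.coe_add, tsub_add_cancel_of_le hs] at this
  simpa using this

theorem le_stepDensity {K : X → PMF X} {s : ℝ≥0} (hs : s ≤ 1) {f : X → ℝ≥0} {ε M : ℝ≥0}
    (hε : ∀ x, ε ≤ f x) (hM : ∀ x, f x ≤ M) (x : X) : ε ≤ stepDensity K s f x := by
  have : ((1 - s : ℝ≥0) : ℝ≥0∞) * ε + s * ε ≤ (stepDensity K s f x : ℝ≥0∞) := by
    rw [coe_stepDensity hM]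
    gcongr
    · exact hε x
    · calc (ε : ℝ≥0∞) = ∑' y, (ε : ℝ≥0∞) * K x y := by
            rw [ENNReal.tsum_mul_left, (K x).tsum_coe, mul_one]
        _ ≤ _ := by gcongr with y; exact hε y
  rw [← add_mul, ← ENNReal.coe_add, tsub_add_cancel_of_le hs] at this
  simpa using this

/-- By reversibility, the inflow at `y` has density `s ∑ (f x - f y)₊ K y x` and the outflow `s ∑ (f
y - f z)₊ K y z`; the difference is `s (K f - f)`. -/
theorem bind_moveRate {K : X → PMF X} {π : PMF X} (hrev : IsReversible K π) {s : ℝ≥0}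
    (hs : s ≤ 1) {f : X → ℝ≥0} {M : ℝ≥0} (hf : ∀ x, 0 < f x) (hM : ∀ x, f x ≤ M) {ν : PMF X}
    (hν : ∀ x, ν x = f x * π x) (hr : ∀ x, ∑' y, moveRate K s f x y ≤ 1) (y : X) :
    ν.bind (lazyKernel (moveRate K s f) hr) y = stepDensity K s f y * π y := by
  have hin : ∑' x, ν x * moveRate K s f x y
      = (∑' x, ((s * (f x - f y) : ℝ≥0) : ℝ≥0∞) * K y x) * π y := by
    rw [← ENNReal.tsum_mul_right]
    refine tsum_congr fun x => ?_
    calc ν x * moveRate K s f x y = ((f x : ℝ≥0∞) * moveRate K s f x y) * π x := by rw [hν]; ring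
      _ = ((s * (f x - f y) : ℝ≥0) : ℝ≥0∞) * (π x * K x y) := by
          rw [density_mul_moveRate s hf]; ring
      _ = _ := by rw [hrev]; ring
  have hout : (f y : ℝ≥0∞) * ∑' z, moveRate K s f y z
      = ∑' z, ((s * (f y - f z) : ℝ≥0) : ℝ≥0∞) * K y z := by
    rw [← ENNReal.tsum_mul_left]
    exact tsum_congr fun z => density_mul_moveRate s hf y z
  have hout_top : (f y : ℝ≥0∞) * ∑' z, moveRate K s f y z ≠ ⊤ :=
    ENNReal.mul_ne_top ENNReal.coe_ne_top (ne_top_of_le_ne_top ENNReal.one_ne_top (hr y))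
  rw [bind_lazyKernel_apply, hin, hν, mul_assoc, mul_comm (π y), ← mul_assoc, ← add_mul]
  congr 1
  refine (ENNReal.add_left_inj hout_top).1 ?_
  rw [add_assoc, ← mul_add, tsub_add_cancel_of_le (hr y), mul_one, hout, coe_stepDensity hM,
    ← ENNReal.tsum_mul_left, add_assoc, ← ENNReal.tsum_add]
  -- With the outflow added to both sides to avoid subtraction, each term is `s max (f z) (f y) K y
  -- z`.
  have hsum : ∀ z, (s : ℝ≥0∞) * ((f z : ℝ≥0∞) * K y z)
      + ((s * (f y - f z) : ℝ≥0) : ℝ≥0∞) * K y z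
      = ((s * (f z - f y) : ℝ≥0) : ℝ≥0∞) * K y z + (s * f y : ℝ≥0) * K y z := by
    intro z
    rw [← mul_assoc, ← ENNReal.coe_mul, ← add_mul, ← add_mul, ← ENNReal.coe_add,
      ← ENNReal.coe_add, ← mul_add, ← mul_add, add_tsub_eq_max, tsub_add_eq_max]
  simp only [hsum]
  rw [ENNReal.tsum_add, ENNReal.tsum_mul_left, (K y).tsum_coe, mul_one, add_left_comm]
  congr 1
  rw [← ENNReal.coe_mul, ← ENNReal.coe_add, ← add_mul, tsub_add_cancel_of_le hs, one_mul]

/-- For `p = √u ≥ q = √v`, `p² - q² ≤ 2 p (p - q)`; then `4 (a p) (p - q)` is split by Young's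
inequality, with weights that make the two parts balance when `a²` has the size allowed by the
hypothesis. -/
theorem four_mul_density_drop_le {C : ℝ≥0} (hC : 0 < C) (a : ℝ≥0∞) (u v : ℝ≥0) :
    2 * (a * ((u - v : ℝ≥0) : ℝ≥0∞)) ≤ C * (u * a ^ 2)
      + 4 / C * (((NNReal.sqrt u - NNReal.sqrt v) ^ 2 : ℝ≥0) : ℝ≥0∞) := by
  rcases le_or_gt u v with h | h
  · simp [tsub_eq_zero_of_le h]
  have hu : 0 < u := lt_of_le_of_lt (zero_le) h
  by_cases ha : a = ⊤
  · simp [ha, hC.ne', hu.ne']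
  lift a to ℝ≥0 using ha
  suffices 2 * (a * (u - v)) ≤ C * (u * a ^ 2) + 4 / C * (NNReal.sqrt u - NNReal.sqrt v) ^ 2 by
    have h4 : (4 : ℝ≥0∞) / C = ((4 / C : ℝ≥0) : ℝ≥0∞) := by
      rw [ENNReal.coe_div hC.ne']; norm_num
    rw [h4]
    exact_mod_cast this
  rw [← NNReal.coe_le_coe]
  push_cast [NNReal.coe_sub h.le, NNReal.coe_sub (NNReal.sqrt_le_sqrt.2 h.le)]
  have hp : (0 : ℝ) ≤ Real.sqrt u := Real.sqrt_nonneg _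
  have hq : (0 : ℝ) ≤ Real.sqrt v := Real.sqrt_nonneg _
  have hpq : Real.sqrt v ≤ Real.sqrt u := Real.sqrt_le_sqrt (by exact_mod_cast h.le)
  have hu2 : (u : ℝ) = Real.sqrt u ^ 2 := (Real.sq_sqrt u.2).symm
  have hv2 : (v : ℝ) = Real.sqrt v ^ 2 := (Real.sq_sqrt v.2).symm
  have ha0 : (0 : ℝ) ≤ a := a.2
  have hC0 : (0 : ℝ) < C := hC
  rw [hu2, hv2]
  simp only [Real.sqrt_sq hp, Real.sqrt_sq hq]
  generalize Real.sqrt u = p at *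
  generalize Real.sqrt v = q at *
  generalize (a : ℝ) = a at *
  generalize (C : ℝ) = c at *
  have h1 : 2 * (a * (p ^ 2 - q ^ 2)) ≤ 4 * (a * p * (p - q)) := by
    nlinarith [mul_nonneg ha0 (sq_nonneg (p - q))]
  have h2 : 4 * (a * p * (p - q)) ≤ c * (p ^ 2 * a ^ 2) + 4 / c * (p - q) ^ 2 := by
    have h3 : 0 ≤ (c * (a * p) - 2 * (p - q)) ^ 2 / c := by positivity
    have h4 : (c * (a * p) - 2 * (p - q)) ^ 2 / c
        = c * (p ^ 2 * a ^ 2) + 4 / c * (p - q) ^ 2 - 4 * (a * p * (p - q)) := by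
      field_simp; ring
    linarith
  exact h1.trans h2

/-- The first-order cost of the move. Young's inequality is summed over edges; the squared drops of
`√f` over decreasing edges add up to exactly `I / 4`. -/
theorem tsum_moveRate_mean_le {K : X → PMF X} {π : PMF X} (hrev : IsReversible K π) {s C : ℝ≥0}
    (hC : 0 < C) {f : X → ℝ≥0} (hf : ∀ x, 0 < f x) {ν : PMF X} (hν : ∀ x, ν x = f x * π x)
    (a : X → ℝ≥0∞) :
    2 * ∑' x, ν x * ((∑' y, moveRate K s f x y) * a x)
      ≤ s * (C * ∑' x, ν x * a x ^ 2 + fisherInfo K π f / C) := by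
  have h1 : ∀ x, ν x * ((∑' y, moveRate K s f x y) * a x)
      = s * ∑' y, a x * ((f x - f y : ℝ≥0) : ℝ≥0∞) * (π x * K x y) := by
    intro x
    rw [hν, ← ENNReal.tsum_mul_right, ← ENNReal.tsum_mul_left, ← ENNReal.tsum_mul_left]
    refine tsum_congr fun y => ?_
    calc (f x : ℝ≥0∞) * π x * (moveRate K s f x y * a x)
        = ((f x : ℝ≥0∞) * moveRate K s f x y) * (π x * a x) := by ring
      _ = _ := by rw [density_mul_moveRate s hf, ENNReal.coe_mul]; ring
  calc 2 * ∑' x, ν x * ((∑' y, moveRate K s f x y) * a x)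
      = s * ∑' x, ∑' y, 2 * (a x * ((f x - f y : ℝ≥0) : ℝ≥0∞)) * (π x * K x y) := by
        simp only [h1, ENNReal.tsum_mul_left, mul_assoc]
        ring
    _ ≤ s * ∑' x, ∑' y, (C * (f x * a x ^ 2)
          + 4 / C * (((NNReal.sqrt (f x) - NNReal.sqrt (f y)) ^ 2 : ℝ≥0) : ℝ≥0∞))
          * (π x * K x y) := by
        gcongr with x y
        exact four_mul_density_drop_le hC _ _ _
    _ = _ := by
        simp only [add_mul, ENNReal.tsum_add]
        rw [tsum_edge_left (fun x => (C : ℝ≥0∞) * (f x * a x ^ 2)),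
          fisherInfo_eq_decreasing hrev, ← ENNReal.tsum_mul_left]
        congr 2
        · refine tsum_congr fun x => by rw [hν]; ring
        · rw [ENNReal.mul_div_right_comm, ← ENNReal.tsum_mul_left]
          simp only [← ENNReal.tsum_mul_left, mul_assoc]

/-- Since `(1 + 2 s) (1 - s) ≥ 1` for `s ≤ 1/2`. This converts an integral against `ν` into one
against the next measure, whose kernel is the one at hand. -/
theorem le_stepDensity_mul {K : X → PMF X} {s : ℝ≥0} (hs : s ≤ 1 / 2) (f : X → ℝ≥0) (x : X) :
    f x ≤ (1 + 2 * s) * stepDensity K s f x := by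
  have h1 : (1 - s) * f x ≤ stepDensity K s f x := le_self_add
  have hs1 : s ≤ 1 := hs.trans (by rw [← NNReal.coe_le_coe]; norm_num)
  refine le_trans ?_ (mul_le_mul_right h1 _)
  rw [← mul_assoc]
  refine le_mul_of_one_le_left (zero_le) ?_
  rw [← NNReal.coe_le_coe] at *
  push_cast [NNReal.coe_sub (show s ≤ 1 from hs1)] at *
  nlinarith [s.2]

/-- One step of the discretised heat flow decreases the weak transport cost by at most the
first-order amount `(2 s / C) I`. -/
theorem weakCost_le_weakCost_step {K : X → PMF X} {π : PMF X} (hirr : IsIrreducible K)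
    (hrev : IsReversible K π) {C s M : ℝ≥0} (hC : 0 < C) (hs : s ≤ 1 / 2)
    (hTI : WeakTransportInformation K π C) {f : X → ℝ≥0} (hf : ∀ x, 0 < f x)
    (hM : ∀ x, f x ≤ M) {ν ν' : PMF X} (hν : ∀ x, ν x = f x * π x)
    (hν' : ∀ x, ν' x = stepDensity K s f x * π x) :
    weakCost (graphDist K) ν π ≤ weakCost (graphDist K) ν' π
      + ENNReal.ofReal (2 * s / C * (fisherInfo K π f).toReal + (8 / C + 2) * s ^ 2) := by
  have hs1 : s ≤ 1 := hs.trans (by rw [← NNReal.coe_le_coe]; norm_num)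
  have hr : ∀ x, ∑' y, moveRate K s f x y ≤ 1 := fun x =>
    (tsum_moveRate_le K s f x).trans (by exact_mod_cast hs1)
  have hbind : ν.bind (lazyKernel (moveRate K s f) hr) = ν' := by
    ext y
    rw [bind_moveRate hrev hs1 hf hM hν, hν']
  have hI4 : fisherInfo K π f ≤ 4 := fisherInfo_le hrev f ν hν
  have hIt : fisherInfo K π f ≠ ⊤ := ne_top_of_le_ne_top (by norm_num) hI4
  have hI4' : (fisherInfo K π f).toReal ≤ 4 := by
    simpa using ENNReal.toReal_mono (by norm_num) hI4
  rw [← tsub_le_iff_right]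
  refine le_iInf₂ fun p hp => ?_
  rw [tsub_le_iff_right]
  set A := ∑' y, ν' y * (∑' z, (graphDist K y z : ℝ≥0∞) * p y z) ^ 2 with hA
  -- If `A` already exceeds the cost of `ν`, nothing is to be proved. Otherwise the hypothesis at
  -- `ν` bounds `A` by the Fisher information of `f` itself, rather than that of the next density.
  rcases le_or_gt (weakCost (graphDist K) ν π) A with hWA | hWA
  · exact hWA.trans le_self_add
  have hAI : A ≤ ENNReal.ofReal (1 / (C : ℝ) ^ 2) * fisherInfo K π f := hWA.le.trans (hTI f ν hν)
  have hAt : A ≠ ⊤ := hWA.ne_top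
  have hstep := weakCost_le_of_lazyKernel (graphDist K) π ν (moveRate K s f) hr
    (tsum_moveRate_le K s f) hs (fun x y z hxy => graphDist_le_succ hirr z
      (pos_iff_ne_zero.2 (right_ne_zero_of_mul hxy))) p (by rw [hbind, hp])
  rw [hbind, ← hA] at hstep
  have hmove := tsum_moveRate_mean_le hrev (s := s) hC hf hν
    (fun x => ∑' z, (graphDist K x z : ℝ≥0∞) * p x z)
  have hνA : ∑' x, ν x * (∑' z, (graphDist K x z : ℝ≥0∞) * p x z) ^ 2
      ≤ ((1 + 2 * s : ℝ≥0) : ℝ≥0∞) * A := by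
    rw [hA, ← ENNReal.tsum_mul_left]
    refine ENNReal.tsum_le_tsum fun x => ?_
    rw [hν, hν', ← mul_assoc, ← mul_assoc, ← ENNReal.coe_mul]
    gcongr
    exact le_stepDensity_mul hs f x
  have hfin : weakCost (graphDist K) ν π
      ≤ A + s * (C * (((1 + 2 * s : ℝ≥0) : ℝ≥0∞) * A) + fisherInfo K π f / C)
        + 2 * (s : ℝ≥0∞) ^ 2 := by
    refine hstep.trans (add_le_add (add_le_add le_rfl (hmove.trans ?_)) le_rfl)
    gcongr
  refine hfin.trans ?_
  rw [add_assoc]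
  gcongr
  obtain ⟨α, hα⟩ := ENNReal.canLift.prf A hAt
  obtain ⟨ι, hι⟩ := ENNReal.canLift.prf (fisherInfo K π f) hIt
  rw [← hα, ← hι] at hAI
  rw [← hι] at hI4'
  rw [← hα, ← hι]
  rw [← ENNReal.coe_div hC.ne']
  have hC0 : (0 : ℝ) < C := hC
  have hαι : (α : ℝ) ≤ 1 / (C : ℝ) ^ 2 * ι := by
    have := ENNReal.toReal_mono (by finiteness) hAI
    rwa [ENNReal.toReal_mul, ENNReal.toReal_ofReal (by positivity), ENNReal.coe_toReal,
      ENNReal.coe_toReal] at this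
  rw [ENNReal.coe_toReal] at hI4' ⊢
  have hcast : (s : ℝ≥0∞) * (C * (((1 + 2 * s : ℝ≥0) : ℝ≥0∞) * α) + ((ι / C : ℝ≥0) : ℝ≥0∞))
        + 2 * (s : ℝ≥0∞) ^ 2
      = ENNReal.ofReal (s * (C * ((1 + 2 * s) * α) + ι / C) + 2 * s ^ 2) := by
    have : (s * (C * ((1 + 2 * s) * α) + ι / C) + 2 * s ^ 2 : ℝ)
        = ((s * (C * ((1 + 2 * s) * α) + ι / C) + 2 * s ^ 2 : ℝ≥0) : ℝ) := by push_cast; ring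
    rw [this, ENNReal.ofReal_coe_nnreal]
    push_cast
    ring
  rw [hcast]
  refine ENNReal.ofReal_le_ofReal ?_
  have hs0 : (0 : ℝ) ≤ s := s.2
  -- The `4` is the bound on the Fisher information; multiplied by `s`, this error becomes `(8 / C)
  -- s²`.
  have h1 : (C : ℝ) * ((1 + 2 * s) * α) ≤ ι / C + 2 * s * (4 / C) := by
    calc (C : ℝ) * ((1 + 2 * s) * α) ≤ C * ((1 + 2 * s) * (1 / (C : ℝ) ^ 2 * ι)) := by gcongr
      _ = ι / C + 2 * s * (ι / C) := by field_simp
      _ ≤ _ := by gcongr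
  calc (s * (C * ((1 + 2 * s) * α) + ι / C) + 2 * s ^ 2 : ℝ)
      ≤ s * (ι / C + 2 * s * (4 / C) + ι / C) + 2 * s ^ 2 := by gcongr
    _ = _ := by ring

/-! ### Entropy dissipation along a step. -/

/-- With `t = √a / √b ≥ 1` this is `log t ≥ 2 (t - 1) / (t + 1)`. It compares entropy production
with Fisher information edge by edge. -/
theorem four_mul_sqrt_sub_sq_le {a b : ℝ} (ha : 0 < a) (hb : 0 < b) :
    4 * (Real.sqrt a - Real.sqrt b) ^ 2 ≤ (a - b) * (Real.log a - Real.log b) := by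
  wlog h : b ≤ a generalizing a b
  · have := this hb ha (le_of_not_ge h)
    nlinarith
  have hp : 0 < Real.sqrt a := Real.sqrt_pos.2 ha
  have hq : 0 < Real.sqrt b := Real.sqrt_pos.2 hb
  have hpq : Real.sqrt b ≤ Real.sqrt a := Real.sqrt_le_sqrt h
  have ha2 : a = Real.sqrt a ^ 2 := (Real.sq_sqrt ha.le).symm
  have hb2 : b = Real.sqrt b ^ 2 := (Real.sq_sqrt hb.le).symm
  generalize Real.sqrt a = p at *
  generalize Real.sqrt b = q at *
  subst ha2 hb2
  rw [Real.log_pow, Real.log_pow, show ((2 : ℕ) : ℝ) = 2 by norm_num]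
  have hx : 0 ≤ p / q - 1 := by rw [sub_nonneg, le_div_iff₀ hq]; linarith
  have hl := Real.le_log_one_add_of_nonneg hx
  rw [show 1 + (p / q - 1) = p / q by ring, Real.log_div hp.ne' hq.ne',
    show 2 * (p / q - 1) / (p / q - 1 + 2) = 2 * (p - q) / (p + q) by
      rw [show p / q - 1 + 2 = (p + q) / q by field_simp; ring,
        show 2 * (p / q - 1) = 2 * (p - q) / q by field_simp]
      field_simp,
    div_le_iff₀ (by positivity)] at hl
  nlinarith [mul_le_mul_of_nonneg_left hl (sub_nonneg.2 hpq)]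

/-- The tangent line of `t log t` at `a` with an explicit quadratic remainder, from `log (b / a) ≤ b
/ a - 1`. -/
theorem mul_log_le {a b : ℝ} (ha : 0 < a) (hb : 0 < b) :
    b * Real.log b ≤ a * Real.log a + (b - a) * (1 + Real.log a) + (b - a) ^ 2 / a := by
  have h := Real.log_le_sub_one_of_pos (div_pos hb ha)
  rw [Real.log_div hb.ne' ha.ne'] at h
  have h2 := mul_le_mul_of_nonneg_left h hb.le
  have h3 : b * (b / a - 1) = (b - a) ^ 2 / a + (b - a) := by field_simp; ring
  nlinarith

theorem summable_pmf_toReal (π : PMF X) : Summable fun x => (π x).toReal :=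
  ENNReal.summable_toReal (by simp)

theorem tsum_pmf_toReal (π : PMF X) : ∑' x, (π x).toReal = 1 := by
  rw [← ENNReal.tsum_toReal_eq π.apply_ne_top, π.tsum_coe]; simp

theorem summable_mul_of_bounded {ι : Type*} {w g : ι → ℝ} (hw : Summable w) (hw0 : ∀ i, 0 ≤ w i)
    {B : ℝ} (hg : ∀ i, |g i| ≤ B) : Summable fun i => g i * w i := by
  refine Summable.of_norm_bounded (hw.mul_left B) fun i => ?_
  rw [Real.norm_eq_abs, abs_mul, abs_of_nonneg (hw0 i)]
  exact mul_le_mul_of_nonneg_right (hg i) (hw0 i)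

/-- The weight `π x * K x y` of the oriented edge `(x, y)`. -/
def edgeWeight (K : X → PMF X) (π : PMF X) (e : X × X) : ℝ := (π e.1 * K e.1 e.2).toReal

theorem edgeWeight_nonneg (K : X → PMF X) (π : PMF X) (e : X × X) : 0 ≤ edgeWeight K π e :=
  ENNReal.toReal_nonneg

theorem summable_edgeWeight (K : X → PMF X) (π : PMF X) : Summable (edgeWeight K π) := by
  refine ENNReal.summable_toReal ?_
  rw [ENNReal.tsum_prod (f := fun x y => π x * K x y)]
  simp [ENNReal.tsum_mul_left]

theorem tsum_edgeWeight_swap {K : X → PMF X} {π : PMF X} (hrev : IsReversible K π)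
    (g : X × X → ℝ) :
    ∑' e, g e * edgeWeight K π e = ∑' e : X × X, g e.swap * edgeWeight K π e := by
  rw [← (Equiv.prodComm X X).tsum_eq]
  refine tsum_congr fun e => ?_
  simp only [edgeWeight, Equiv.prodComm_apply, Prod.fst_swap, Prod.snd_swap]
  rw [hrev e.2 e.1]

theorem tsum_edgeWeight_eq {K : X → PMF X} {π : PMF X} {g : X → ℝ} {h : X × X → ℝ} {A B : ℝ}
    (hg : ∀ x, |g x| ≤ A) (hh : ∀ e, |h e| ≤ B) :
    ∑' e : X × X, h e * g e.1 * edgeWeight K π e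
      = ∑' x, (∑' y, h (x, y) * (K x y).toReal) * g x * (π x).toReal := by
  have hb : ∀ e : X × X, |h e * g e.1| ≤ B * A := fun e => by
    rw [abs_mul]
    exact mul_le_mul (hh e) (hg e.1) (abs_nonneg _) ((abs_nonneg _).trans (hh e))
  rw [Summable.tsum_prod (summable_mul_of_bounded (summable_edgeWeight K π)
    (edgeWeight_nonneg K π) hb)]
  refine tsum_congr fun x => ?_
  rw [mul_assoc, ← tsum_mul_right]
  refine tsum_congr fun y => ?_
  simp only [edgeWeight, ENNReal.toReal_mul]
  ring

theorem toReal_fisherInfo {K : X → PMF X} {π : PMF X} (f : X → ℝ≥0) :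
    (fisherInfo K π f).toReal
      = 2 * ∑' e : X × X, (Real.sqrt (f e.2) - Real.sqrt (f e.1)) ^ 2 * edgeWeight K π e := by
  rw [fisherInfo_eq, ENNReal.toReal_mul, ← ENNReal.tsum_prod (f := fun x y =>
    ENNReal.ofReal ((Real.sqrt (f y) - Real.sqrt (f x)) ^ 2) * (π x * K x y)),
    ENNReal.tsum_toReal_eq]
  · congr 1
    refine tsum_congr fun e => ?_
    rw [ENNReal.toReal_mul, ENNReal.toReal_ofReal (sq_nonneg _), edgeWeight]
  · exact fun e => ENNReal.mul_ne_top ENNReal.ofReal_ne_top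
      (ENNReal.mul_ne_top (π.apply_ne_top _) ((K _).apply_ne_top _))

/-- The generator `(K - 1) f`. -/
def generator (K : X → PMF X) (f : X → ℝ≥0) (x : X) : ℝ :=
  ∑' y, ((f y : ℝ) - f x) * (K x y).toReal

theorem abs_sub_le_of_le {u v M : ℝ≥0} (hu : u ≤ M) (hv : v ≤ M) : |(u : ℝ) - v| ≤ M := by
  have hu' : (u : ℝ) ≤ M := hu
  have hv' : (v : ℝ) ≤ M := hv
  rw [abs_le]
  constructor <;> linarith [u.coe_nonneg, v.coe_nonneg]

theorem coe_stepDensity_eq {K : X → PMF X} {s M : ℝ≥0} (hs : s ≤ 1) {f : X → ℝ≥0}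
    (hM : ∀ x, f x ≤ M) (x : X) : (stepDensity K s f x : ℝ) = f x + s * generator K f x := by
  have h1 : Summable fun y => (f y : ℝ) * (K x y).toReal :=
    summable_mul_of_bounded (summable_pmf_toReal (K x)) (fun _ => ENNReal.toReal_nonneg)
      (B := M) fun y => by rw [NNReal.abs_eq]; exact hM y
  have h2 : generator K f x = ∑' y, (f y : ℝ) * (K x y).toReal - f x := by
    unfold generator
    simp only [sub_mul]
    rw [h1.tsum_sub ((summable_pmf_toReal (K x)).mul_left _), tsum_mul_left, tsum_pmf_toReal,
      mul_one]
  have h3 : (∑' y, (f y : ℝ≥0∞) * K x y).toReal = ∑' y, (f y : ℝ) * (K x y).toReal := by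
    rw [ENNReal.tsum_toReal_eq]
    · simp only [ENNReal.toReal_mul, ENNReal.coe_toReal]
    · exact fun y => ENNReal.mul_ne_top ENNReal.coe_ne_top ((K x).apply_ne_top y)
  unfold stepDensity
  push_cast [NNReal.coe_sub hs]
  rw [h3, h2]
  ring

theorem abs_generator_le {K : X → PMF X} {M : ℝ≥0} {f : X → ℝ≥0} (hM : ∀ x, f x ≤ M) (x : X) :
    |generator K f x| ≤ M := by
  have hb : ∀ y, ‖((f y : ℝ) - f x) * (K x y).toReal‖ ≤ M * (K x y).toReal := fun y => by
    rw [norm_mul, Real.norm_eq_abs, Real.norm_of_nonneg ENNReal.toReal_nonneg]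
    exact mul_le_mul_of_nonneg_right (abs_sub_le_of_le (hM y) (hM x)) ENNReal.toReal_nonneg
  have := tsum_of_norm_bounded ((summable_pmf_toReal (K x)).hasSum.mul_left (M : ℝ)) hb
  rwa [tsum_pmf_toReal, mul_one] at this

/-- `∑ f log f π` -/
def entropySum (π : PMF X) (f : X → ℝ≥0) : ℝ := ∑' x, (f x : ℝ) * Real.log (f x) * (π x).toReal

theorem abs_log_le {ε M u : ℝ≥0} (hε : 0 < ε) (h1 : ε ≤ u) (h2 : u ≤ M) :
    |Real.log u| ≤ |Real.log ε| + |Real.log M| := by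
  have h3 : Real.log ε ≤ Real.log u := Real.log_le_log hε h1
  have h4 : Real.log u ≤ Real.log M := Real.log_le_log (lt_of_lt_of_le hε h1) h2
  rw [abs_le]
  constructor
  · linarith [neg_abs_le (Real.log ε), abs_nonneg (Real.log M)]
  · linarith [le_abs_self (Real.log M), abs_nonneg (Real.log ε)]

theorem summable_entropy (π : PMF X) {ε M : ℝ≥0} (hε : 0 < ε) {f : X → ℝ≥0} (h1 : ∀ x, ε ≤ f x)
    (h2 : ∀ x, f x ≤ M) : Summable fun x => (f x : ℝ) * Real.log (f x) * (π x).toReal :=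
  summable_mul_of_bounded (summable_pmf_toReal π) (fun _ => ENNReal.toReal_nonneg)
    (B := M * (|Real.log ε| + |Real.log M|)) fun x => by
      rw [abs_mul, NNReal.abs_eq]
      exact mul_le_mul (h2 x) (abs_log_le hε (h1 x) (h2 x)) (abs_nonneg _) M.2

/-- The entropy production dominates the Fisher information. -/
theorem tsum_generator_mul_log_le {K : X → PMF X} {π : PMF X} (hrev : IsReversible K π)
    {ε M : ℝ≥0} (hε : 0 < ε) {f : X → ℝ≥0} (h1 : ∀ x, ε ≤ f x) (h2 : ∀ x, f x ≤ M) :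
    ∑' x, generator K f x * (1 + Real.log (f x)) * (π x).toReal
      ≤ -(fisherInfo K π f).toReal := by
  have hf : ∀ x, (0 : ℝ) < f x := fun x => lt_of_lt_of_le hε (h1 x)
  have hg : ∀ x, |1 + Real.log (f x)| ≤ 1 + (|Real.log ε| + |Real.log M|) := fun x =>
    (abs_add_le _ _).trans (by rw [abs_one]; gcongr; exact abs_log_le hε (h1 x) (h2 x))
  have hh : ∀ e : X × X, |(f e.2 : ℝ) - f e.1| ≤ M := fun e => abs_sub_le_of_le (h2 _) (h2 _)
  have hS1 : Summable fun e : X × X => (((f e.2 : ℝ) - f e.1) * (1 + Real.log (f e.1)))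
      * edgeWeight K π e := by
    refine summable_mul_of_bounded (summable_edgeWeight K π) (edgeWeight_nonneg K π)
      (B := M * (1 + (|Real.log ε| + |Real.log M|))) fun e => ?_
    rw [abs_mul]
    exact mul_le_mul (hh e) (hg e.1) (abs_nonneg _) M.2
  have hS2 : Summable fun e : X × X => (((f e.1 : ℝ) - f e.2) * (1 + Real.log (f e.2)))
      * edgeWeight K π e := by
    refine summable_mul_of_bounded (summable_edgeWeight K π) (edgeWeight_nonneg K π)
      (B := M * (1 + (|Real.log ε| + |Real.log M|))) fun e => ?_
    rw [abs_mul]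
    exact mul_le_mul (by rw [abs_sub_comm]; exact hh e) (hg e.2) (abs_nonneg _) M.2
  have hS3 : Summable fun e : X × X => (Real.sqrt (f e.2) - Real.sqrt (f e.1)) ^ 2
      * edgeWeight K π e := by
    refine summable_mul_of_bounded (summable_edgeWeight K π) (edgeWeight_nonneg K π)
      (B := M) fun e => ?_
    rw [abs_of_nonneg (sq_nonneg _)]
    have hu : Real.sqrt (f e.2) ≤ Real.sqrt M := Real.sqrt_le_sqrt (h2 e.2)
    have hv : Real.sqrt (f e.1) ≤ Real.sqrt M := Real.sqrt_le_sqrt (h2 e.1)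
    have hM : Real.sqrt M ^ 2 = M := Real.sq_sqrt M.2
    nlinarith [Real.sqrt_nonneg (f e.2), Real.sqrt_nonneg (f e.1)]
  have hE := tsum_edgeWeight_eq (K := K) (π := π) hg hh
  -- Discrete integration by parts: averaging the edge sum with its reversal turns the sum into
  -- `-1/2 ∑ (f y - f x) (log f y - log f x) π K`.
  have hsw := tsum_edgeWeight_swap hrev
    (fun e : X × X => ((f e.2 : ℝ) - f e.1) * (1 + Real.log (f e.1)))
  simp only [Prod.fst_swap, Prod.snd_swap] at hsw
  have hle : ∑' e : X × X, (((f e.2 : ℝ) - f e.1) * (1 + Real.log (f e.1))) * edgeWeight K π e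
      + ∑' e : X × X, (((f e.1 : ℝ) - f e.2) * (1 + Real.log (f e.2))) * edgeWeight K π e
      ≤ -4 * ∑' e : X × X, (Real.sqrt (f e.2) - Real.sqrt (f e.1)) ^ 2 * edgeWeight K π e := by
    rw [← hS1.tsum_add hS2, ← tsum_mul_left]
    refine (hS1.add hS2).tsum_le_tsum (fun e => ?_) (hS3.mul_left _)
    have := four_mul_sqrt_sub_sq_le (hf e.2) (hf e.1)
    have := mul_le_mul_of_nonneg_right this (edgeWeight_nonneg K π e)
    linarith
  rw [toReal_fisherInfo]
  have : ∑' x, generator K f x * (1 + Real.log (f x)) * (π x).toReal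
      = ∑' e : X × X, (((f e.2 : ℝ) - f e.1) * (1 + Real.log (f e.1))) * edgeWeight K π e :=
    hE.symm
  linarith

/-- One step of the discretised heat flow dissipates entropy. -/
theorem entropySum_step_le {K : X → PMF X} {π : PMF X} (hrev : IsReversible K π)
    {ε M s : ℝ≥0} (hs : s ≤ 1) (hε : 0 < ε) {f : X → ℝ≥0} (h1 : ∀ x, ε ≤ f x)
    (h2 : ∀ x, f x ≤ M) :
    entropySum π (stepDensity K s f) + s * (fisherInfo K π f).toReal
      ≤ entropySum π f + M ^ 2 / ε * s ^ 2 := by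
  have hε' : (0 : ℝ) < ε := hε
  have hw := summable_pmf_toReal π
  have hw0 : ∀ x, 0 ≤ (π x).toReal := fun _ => ENNReal.toReal_nonneg
  have hf : ∀ x, (0 : ℝ) < f x := fun x => lt_of_lt_of_le hε (h1 x)
  have hS1 := summable_entropy π hε h1 h2
  have hS2 : Summable fun x => generator K f x * (1 + Real.log (f x)) * (π x).toReal :=
    summable_mul_of_bounded hw hw0 (B := M * (1 + (|Real.log ε| + |Real.log M|))) fun x => by
      rw [abs_mul]
      refine mul_le_mul (abs_generator_le h2 x) ?_ (abs_nonneg _) M.2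
      exact (abs_add_le _ _).trans (by rw [abs_one]; gcongr; exact abs_log_le hε (h1 x) (h2 x))
  have hS3 := summable_entropy π hε (le_stepDensity (K := K) hs h1 h2) (stepDensity_le hs h2)
  have hpt : ∀ x, (stepDensity K s f x : ℝ) * Real.log (stepDensity K s f x) * (π x).toReal
      ≤ (f x : ℝ) * Real.log (f x) * (π x).toReal
        + s * (generator K f x * (1 + Real.log (f x)) * (π x).toReal)
        + M ^ 2 / ε * s ^ 2 * (π x).toReal := by
    intro x
    have hpos : (0 : ℝ) < stepDensity K s f x :=
      lt_of_lt_of_le hε (le_stepDensity (K := K) hs h1 h2 x)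
    have h := mul_log_le (hf x) hpos
    have hd : (stepDensity K s f x : ℝ) - f x = s * generator K f x := by
      rw [coe_stepDensity_eq hs h2]; ring
    rw [hd] at h
    have he : (s * generator K f x) ^ 2 / f x ≤ M ^ 2 / ε * s ^ 2 := by
      calc (s * generator K f x) ^ 2 / f x ≤ (s * M) ^ 2 / ε := by
            have h3 : (s * generator K f x) ^ 2 ≤ (s * M) ^ 2 := by
              rw [mul_pow, mul_pow]
              exact mul_le_mul_of_nonneg_left
                (sq_le_sq' (neg_le_of_abs_le (abs_generator_le h2 x))
                  (le_of_abs_le (abs_generator_le h2 x))) (sq_nonneg _)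
            exact div_le_div₀ (sq_nonneg _) h3 hε' (h1 x)
        _ = _ := by ring
    have := mul_le_mul_of_nonneg_right (h.trans (add_le_add_right he _)) (hw0 x)
    linarith
  have hsum := hS3.tsum_le_tsum hpt
    ((hS1.add (hS2.mul_left (s : ℝ))).add (hw.mul_left (M ^ 2 / ε * s ^ 2 : ℝ)))
  rw [(hS1.add (hS2.mul_left (s : ℝ))).tsum_add (hw.mul_left _), hS1.tsum_add (hS2.mul_left _),
    tsum_mul_left, tsum_mul_left, tsum_pmf_toReal, mul_one] at hsum
  have hprod := mul_le_mul_of_nonneg_left (tsum_generator_mul_log_le (K := K) hrev hε h1 h2)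
    (show (0 : ℝ) ≤ s from s.2)
  unfold entropySum
  linarith

/-! ### Lower semicontinuity of the weak cost. -/

theorem pmf_eq_of_le {μ ν : PMF X} (h : ∀ x, μ x ≤ ν x) : μ = ν := by
  ext x
  by_contra hx
  have := ENNReal.tsum_lt_tsum (by simp) h (lt_of_le_of_ne (h x) hx)
  simp at this

open Filter Topology in
/-- If the first marginals and the kernels of transports to `μ` converge pointwise, then the limit
is again a transport to `μ`, because the second marginal is fixed, and its cost is at most the limit
of the costs. -/
theorem weakCost_le_of_tendsto_kernel {ι : Type*} {U : Filter ι} [U.NeBot] (d : X → X → ℕ)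
    {μ ν : PMF X} {νs : ι → PMF X} (hν' : ∀ x, Tendsto (fun n => νs n x) U (𝓝 (ν x)))
    {p : ι → X → PMF X} (hpm : ∀ n, (νs n).bind (p n) = μ) {q : X → X → ℝ≥0∞}
    (hq : ∀ y x, Tendsto (fun n => p n y x) U (𝓝 (q y x))) {c : ι → ℝ≥0∞} {b : ℝ≥0∞}
    (hc : ∀ᶠ n in U, ∑' y, νs n y * (∑' x, (d y x : ℝ≥0∞) * p n y x) ^ 2 ≤ c n)
    (hb : Tendsto c U (𝓝 b)) : weakCost d ν μ ≤ b := by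
  classical
  have hq1 : ∀ y x, q y x ≤ 1 := fun y x => le_of_tendsto' (hq y x) fun n => (p n y).coe_le_one x
  have hqt : ∀ y x, q y x ≠ ⊤ := fun y x => ne_top_of_le_ne_top ENNReal.one_ne_top (hq1 y x)
  have hνq : ∀ y x, Tendsto (fun n => νs n y * p n y x) U (𝓝 (ν y * q y x)) := fun y x =>
    ENNReal.Tendsto.mul (hν' y) (Or.inr (hqt y x)) (hq y x) (Or.inr (ν.apply_ne_top y))
  have hmarg : ∀ n y x, νs n y * p n y x ≤ μ x := by
    intro n y x
    rw [← hpm n, PMF.bind_apply]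
    exact ENNReal.le_tsum y
  have hsub : ∀ y, ∑' x, q y x ≤ 1 := by
    intro y
    rw [ENNReal.tsum_eq_iSup_sum]
    refine iSup_le fun G => le_of_tendsto' (tendsto_finsetSum G fun x _ => hq y x) fun n => ?_
    exact (ENNReal.sum_le_tsum G).trans (p n y).tsum_coe.le
  -- No mass escapes: outside a finite set `G` the joint mass at `y` is at most `μ` of the
  -- complement of `G`, uniformly in `n`.
  have hone : ∀ y, ν y ≠ 0 → ∑' x, q y x = 1 := by
    intro y hy
    refine le_antisymm (hsub y) ?_
    have hG : ∀ G : Finset X, ν y ≤ ν y * (∑' x, q y x) + ∑' x : {x // x ∉ G}, μ x := by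
      intro G
      have h1 : ∀ n, νs n y ≤ ∑ x ∈ G, νs n y * p n y x + ∑' x : {x // x ∉ G}, μ x := by
        intro n
        calc νs n y = ∑' x, νs n y * p n y x := by
              rw [ENNReal.tsum_mul_left, (p n y).tsum_coe, mul_one]
          _ = ∑ x ∈ G, νs n y * p n y x + ∑' x : {x // x ∉ G}, νs n y * p n y x :=
              (ENNReal.sum_add_tsum_compl G fun x => νs n y * p n y x).symm
          _ ≤ _ := by gcongr with x; exact hmarg n y x
      have h2 : ν y ≤ ∑ x ∈ G, ν y * q y x + ∑' x : {x // x ∉ G}, μ x :=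
        le_of_tendsto_of_tendsto' (hν' y)
          ((tendsto_finsetSum G fun x _ => hνq y x).add tendsto_const_nhds) h1
      refine h2.trans ?_
      rw [← Finset.mul_sum]
      gcongr
      exact ENNReal.sum_le_tsum G
    have hlim : ν y ≤ ν y * (∑' x, q y x) + 0 :=
      ge_of_tendsto' (tendsto_const_nhds.add
        (ENNReal.tendsto_tsum_compl_atTop_zero (by simp : ∑' x, μ x ≠ ⊤))) hG
    rw [add_zero] at hlim
    by_contra hlt
    rw [not_le] at hlt
    have := ENNReal.mul_lt_mul_right hy (ν.apply_ne_top y) hlt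
    rw [mul_one] at this
    exact absurd hlim (not_le.2 this)
  -- Where `ν y = 0` the limit may lose mass; the value `μ` there is arbitrary and carries no
  -- weight.
  let P : X → PMF X := fun y => if h : ∑' x, q y x = 1 then
    ⟨q y, (Summable.hasSum_iff ENNReal.summable).2 h⟩ else μ
  have hP : ∀ y, ν y ≠ 0 → ∀ x, P y x = q y x := by
    intro y hy x
    have h : P y = ⟨q y, (Summable.hasSum_iff ENNReal.summable).2 (hone y hy)⟩ :=
      dif_pos (hone y hy)
    rw [h]
    rfl
  have hνP : ∀ y x, ν y * P y x = ν y * q y x := by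
    intro y x
    by_cases hy : ν y = 0
    · simp [hy]
    · rw [hP y hy]
  -- Passing finite sums to the limit gives only `≤`; equality follows because both sides have mass
  -- one.
  have hPm : ν.bind P = μ := by
    refine pmf_eq_of_le fun x => ?_
    simp only [PMF.bind_apply, hνP]
    rw [ENNReal.tsum_eq_iSup_sum]
    refine iSup_le fun F => le_of_tendsto' (tendsto_finsetSum F fun y _ => hνq y x) fun n => ?_
    rw [← hpm n, PMF.bind_apply]
    exact ENNReal.sum_le_tsum F
  refine (iInf₂_le P hPm).trans ?_
  have hcost : ∑' y, ν y * (∑' x, (d y x : ℝ≥0∞) * P y x) ^ 2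
      ≤ ∑' y, ν y * (∑' x, (d y x : ℝ≥0∞) * q y x) ^ 2 := by
    refine ENNReal.tsum_le_tsum fun y => ?_
    by_cases hy : ν y = 0
    · simp [hy]
    · simp only [hP y hy, le_refl]
  refine hcost.trans ?_
  have hfin : ∀ F G : Finset X, ∑ y ∈ F, ν y * (∑ x ∈ G, (d y x : ℝ≥0∞) * q y x) ^ 2 ≤ b := by
    intro F G
    have hinner : ∀ y, Tendsto (fun n => (∑ x ∈ G, (d y x : ℝ≥0∞) * p n y x) ^ 2) U
        (𝓝 ((∑ x ∈ G, (d y x : ℝ≥0∞) * q y x) ^ 2)) := fun y =>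
      ((ENNReal.continuous_pow 2).tendsto _).comp (tendsto_finsetSum G fun x _ =>
        ENNReal.Tendsto.const_mul (hq y x) (Or.inr (ENNReal.natCast_ne_top _)))
    have hint : ∀ y, (∑ x ∈ G, (d y x : ℝ≥0∞) * q y x) ^ 2 ≠ ⊤ := fun y =>
      ENNReal.pow_ne_top (ENNReal.sum_ne_top.2 fun x _ =>
        ENNReal.mul_ne_top (ENNReal.natCast_ne_top _) (hqt y x))
    refine le_of_tendsto_of_tendsto (tendsto_finsetSum F fun y _ =>
      ENNReal.Tendsto.mul (hν' y) (Or.inr (hint y)) (hinner y) (Or.inr (ν.apply_ne_top y))) hb ?_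
    filter_upwards [hc] with n hn
    refine le_trans ?_ hn
    refine le_trans ?_ (ENNReal.sum_le_tsum F)
    gcongr with y
    exact ENNReal.sum_le_tsum G
  rw [ENNReal.tsum_eq_iSup_sum]
  refine iSup_le fun F => ?_
  refine le_of_tendsto' (x := atTop) (f := fun G : Finset X =>
    ∑ y ∈ F, ν y * (∑ x ∈ G, (d y x : ℝ≥0∞) * q y x) ^ 2) (tendsto_finsetSum F fun y _ => ?_)
    (hfin F)
  exact ENNReal.Tendsto.const_mul (((ENNReal.continuous_pow 2).tendsto _).comp
    ENNReal.summable.hasSum) (Or.inr (ν.apply_ne_top y))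

open Filter Topology in
/-- The weak transport cost is lower semicontinuous in its first argument with respect to pointwise
convergence: an ultrafilter limit of near-optimal kernels is a kernel because the second marginal is
fixed. -/
theorem weakCost_le_of_tendsto (d : X → X → ℕ) {μ ν : PMF X} {νs : ℕ → PMF X}
    (hν : ∀ x, Tendsto (fun n => νs n x) atTop (𝓝 (ν x))) {c : ℕ → ℝ≥0∞} {b : ℝ≥0∞}
    (hc : ∀ n, weakCost d (νs n) μ ≤ c n) (hb : Tendsto c atTop (𝓝 b)) :
    weakCost d ν μ ≤ b := by
  classical
  rcases eq_or_ne b ⊤ with rfl | hbt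
  · exact le_top
  have hex : ∀ n, ∃ p : X → PMF X, (νs n).bind p = μ ∧ (c n ≠ ⊤ →
      ∑' y, νs n y * (∑' x, (d y x : ℝ≥0∞) * p y x) ^ 2 ≤ c n + ((n : ℝ≥0∞) + 1)⁻¹) := by
    intro n
    by_cases hcn : c n = ⊤
    · exact ⟨fun _ => μ, by simp, fun h => absurd hcn h⟩
    · have : weakCost d (νs n) μ < c n + ((n : ℝ≥0∞) + 1)⁻¹ :=
        lt_of_le_of_lt (hc n) (ENNReal.lt_add_right hcn (by simp))
      obtain ⟨p, hp⟩ := iInf_lt_iff.1 this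
      obtain ⟨hp1, hp2⟩ := iInf_lt_iff.1 hp
      exact ⟨p, hp1, fun _ => hp2.le⟩
  choose p hpm hpc using hex
  -- By compactness of `ℝ≥0∞`, one ultrafilter makes all entries of the kernels converge at once,
  -- with no diagonal extraction.
  let U : Ultrafilter ℕ := hyperfilter ℕ
  have hU : (U : Filter ℕ) ≤ atTop := Nat.cofinite_eq_atTop ▸ hyperfilter_le_cofinite
  let q : X → X → ℝ≥0∞ := fun y x => (U.map fun n => p n y x).lim
  have hq : ∀ y x, Tendsto (fun n => p n y x) U (𝓝 (q y x)) := fun y x =>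
    Ultrafilter.le_nhds_lim (U.map fun n => p n y x)
  have hν' : ∀ x, Tendsto (fun n => νs n x) U (𝓝 (ν x)) := fun x => (hν x).mono_left hU
  have hbn : Tendsto (fun n => c n + ((n : ℝ≥0∞) + 1)⁻¹) U (𝓝 b) := by
    have h0 : Tendsto (fun n : ℕ => ((n : ℝ≥0∞) + 1)⁻¹) atTop (𝓝 0) := by
      have := (ENNReal.tendsto_inv_nat_nhds_zero).comp (tendsto_add_atTop_nat 1)
      refine this.congr fun n => by simp
    simpa using (hb.add h0).mono_left hU
  have hev : ∀ᶠ n in (U : Filter ℕ), c n ≠ ⊤ := (hb.mono_left hU).eventually_ne hbt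
  exact weakCost_le_of_tendsto_kernel d hν' hpm hq (hev.mono hpc) hbn

/-! ### The discrete Otto–Villani argument and bounded densities. -/

/-- A discrete-time Otto–Villani argument: if along steps of every small size `s` the quantity `W`
loses at most `(2 s / C) I` and `E` loses at least `s I`, up to errors of order `s ^ 2`, and
`W ≤ I / C ^ 2`, then `W ≤ (2 / C) E`. -/
theorem le_entropy_of_step {S : Type*} {W E I : S → ℝ} {C c : ℝ} (hC : 0 < C) (hc : 0 ≤ c)
    (hE : ∀ σ, 0 ≤ E σ) (hWI : ∀ σ, W σ ≤ I σ / C ^ 2)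
    (hstep : ∀ σ s, 0 < s → s ≤ 1 / 2 → ∃ σ', W σ ≤ W σ' + 2 * s / C * I σ + c * s ^ 2 ∧
      E σ' + s * I σ ≤ E σ + c * s ^ 2) (σ : S) : W σ ≤ 2 / C * E σ := by
  -- Either `I ≤ J` occurs within `n` steps, giving the bound on `W`, or each step costs the entropy
  -- at least `s J` up to error.
  have iter : ∀ s, 0 < s → s ≤ 1 / 2 → ∀ J : ℝ, ∀ (n : ℕ) (σ : S),
      W σ ≤ 2 / C * E σ + n * ((c + 2 / C * c) * s ^ 2) + J / C ^ 2 ∨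
      n * s * J ≤ E σ + n * (c * s ^ 2) := by
    intro s hs0 hs J n
    induction n with
    | zero => intro σ; right; simpa using hE σ
    | succ n ih =>
      intro σ
      have hn : (0 : ℝ) ≤ n := n.cast_nonneg
      rcases le_or_gt (I σ) J with hIJ | hIJ
      · left
        have h1 : W σ ≤ J / C ^ 2 := (hWI σ).trans (by gcongr)
        have h2 : 0 ≤ 2 / C * E σ := mul_nonneg (by positivity) (hE σ)
        have h3 : 0 ≤ ((n + 1 : ℕ) : ℝ) * ((c + 2 / C * c) * s ^ 2) := by positivity
        linarith
      · obtain ⟨σ', hW, hE'⟩ := hstep σ s hs0 hs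
        push_cast
        rcases ih σ' with h | h
        · left
          have h1 := mul_le_mul_of_nonneg_left hE' (show 0 ≤ 2 / C by positivity)
          have h2 : 2 / C * (E σ' + s * I σ) = 2 / C * E σ' + 2 * s / C * I σ := by ring
          rw [h2] at h1
          nlinarith
        · right
          nlinarith [mul_lt_mul_of_pos_left hIJ hs0]
  have key : ∀ η : ℝ, 0 < η → W σ ≤ 2 / C * E σ + (η + η / C ^ 2) := by
    intro η hη
    -- Over total time `T` the entropy would have to fall by `T η = E σ + 1`, more than is
    -- available.
    set T := (E σ + 1) / η with hT
    have hE0 := hE σ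
    have hT0 : 0 < T := by positivity
    -- The three summands ensure a step `T / n ≤ 1/2`, a total entropy error below `1` and a total
    -- cost error of at most `η`.
    obtain ⟨n, hn⟩ := exists_nat_gt (2 * T + c * T ^ 2 + (c + 2 / C * c) * T ^ 2 / η)
    have h1 : 0 ≤ c * T ^ 2 := by positivity
    have h2 : 0 ≤ (c + 2 / C * c) * T ^ 2 / η := by positivity
    have hn0 : (0 : ℝ) < n := by linarith
    have hs : T / n ≤ 1 / 2 := by
      rw [div_le_iff₀ hn0]; linarith
    have hns : (n : ℝ) * (T / n) ^ 2 = T ^ 2 / n := by field_simp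
    rcases iter (T / n) (by positivity) hs η n σ with h | h
    · have h3 : (n : ℝ) * ((c + 2 / C * c) * (T / n) ^ 2) ≤ η := by
        calc (n : ℝ) * ((c + 2 / C * c) * (T / n) ^ 2)
            = (c + 2 / C * c) * ((n : ℝ) * (T / n) ^ 2) := by ring
          _ = (c + 2 / C * c) * T ^ 2 / n := by rw [hns]; ring
          _ ≤ η := by
            rw [div_le_iff₀ hn0]
            have : (c + 2 / C * c) * T ^ 2 / η < n := by linarith
            rw [div_lt_iff₀ hη] at this
            linarith
      linarith
    · exfalso
      have h3 : (n : ℝ) * (T / n) * η = E σ + 1 := by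
        rw [hT]; field_simp
      have h4 : (n : ℝ) * (c * (T / n) ^ 2) = c * T ^ 2 / n := by
        calc (n : ℝ) * (c * (T / n) ^ 2) = c * ((n : ℝ) * (T / n) ^ 2) := by ring
          _ = _ := by rw [hns]; ring
      have h5 : c * T ^ 2 / n < 1 := by
        rw [div_lt_one hn0]; linarith
      linarith
  refine le_of_forall_pos_le_add fun δ hδ => ?_
  have hC2 : 0 < 1 + 1 / C ^ 2 := by positivity
  refine (key (δ / (1 + 1 / C ^ 2)) (by positivity)).trans (le_of_eq ?_)
  field_simp

theorem tsum_density {π ν : PMF X} {f : X → ℝ≥0} (hν : ∀ x, ν x = f x * π x) :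
    ∑' x, (f x : ℝ) * (π x).toReal = 1 := by
  rw [← tsum_pmf_toReal ν]
  exact tsum_congr fun x => by rw [hν, ENNReal.toReal_mul, ENNReal.coe_toReal]

theorem summable_density {π ν : PMF X} {f : X → ℝ≥0} (hν : ∀ x, ν x = f x * π x) :
    Summable fun x => (f x : ℝ) * (π x).toReal :=
  (summable_pmf_toReal ν).congr fun x => by rw [hν, ENNReal.toReal_mul, ENNReal.coe_toReal]

/-- Integrate `t log t ≥ t - 1`, both densities having mass one. -/
theorem entropySum_nonneg {π ν : PMF X} {f : X → ℝ≥0} (hν : ∀ x, ν x = f x * π x)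
    (hS : Summable fun x => (f x : ℝ) * Real.log (f x) * (π x).toReal) : 0 ≤ entropySum π f := by
  have h : ∀ x, (f x : ℝ) * (π x).toReal - (π x).toReal
      ≤ (f x : ℝ) * Real.log (f x) * (π x).toReal := by
    intro x
    rw [← sub_one_mul]
    refine mul_le_mul_of_nonneg_right ?_ ENNReal.toReal_nonneg
    rcases (f x).2.eq_or_lt with h0 | h0
    · have : (f x : ℝ) = 0 := h0.symm
      rw [this]; norm_num
    · have h0' : (0 : ℝ) < f x := h0
      have := mul_le_mul_of_nonneg_left (Real.one_sub_inv_le_log_of_pos h0') h0'.le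
      rwa [mul_sub, mul_inv_cancel₀ h0'.ne', mul_one] at this
  have := ((summable_density hν).sub (summable_pmf_toReal π)).tsum_le_tsum h hS
  rw [(summable_density hν).tsum_sub (summable_pmf_toReal π), tsum_density hν, tsum_pmf_toReal,
    sub_self] at this
  exact this

/-- The transport-entropy inequality for densities bounded away from `0` and `∞`. -/
theorem weakCost_le_of_bounded {K : X → PMF X} {π : PMF X} (hirr : IsIrreducible K)
    (hrev : IsReversible K π) {C ε M : ℝ≥0} (hC : 0 < C)
    (hTI : WeakTransportInformation K π C) (hε : 0 < ε) {f : X → ℝ≥0} (h1 : ∀ x, ε ≤ f x)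
    (h2 : ∀ x, f x ≤ M) {ν : PMF X} (hν : ∀ x, ν x = f x * π x) :
    weakCost (graphDist K) ν π ≤ ENNReal.ofReal (2 / C * entropySum π f) := by
  -- The bounds `ε` and `M` belong to the state: the step averages `f`, hence preserves them, and
  -- one error constant serves the whole iteration.
  let S := {σ : (X → ℝ≥0) × PMF X // (∀ x, ε ≤ σ.1 x) ∧ (∀ x, σ.1 x ≤ M) ∧
    ∀ x, σ.2 x = σ.1 x * π x}
  have hI4 : ∀ σ : S, fisherInfo K π σ.1.1 ≤ 4 := fun σ => fisherInfo_le hrev _ _ σ.2.2.2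
  have hIt : ∀ σ : S, fisherInfo K π σ.1.1 ≠ ⊤ := fun σ =>
    ne_top_of_le_ne_top (by norm_num) (hI4 σ)
  have hWt : ∀ σ : S, weakCost (graphDist K) σ.1.2 π ≠ ⊤ := fun σ =>
    ne_top_of_le_ne_top (ENNReal.mul_ne_top ENNReal.ofReal_ne_top (hIt σ)) (hTI _ _ σ.2.2.2)
  have hC' : (0 : ℝ) < C := hC
  have hε' : (0 : ℝ) < ε := hε
  have main := le_entropy_of_step (S := S)
    (W := fun σ => (weakCost (graphDist K) σ.1.2 π).toReal)
    (E := fun σ => entropySum π σ.1.1) (I := fun σ => (fisherInfo K π σ.1.1).toReal)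
    (C := C) (c := (8 / C + 2) + M ^ 2 / ε) hC' (by positivity)
    (fun σ => entropySum_nonneg σ.2.2.2 (summable_entropy π hε σ.2.1 σ.2.2.1))
    (fun σ => by
      have h := ENNReal.toReal_mono (ENNReal.mul_ne_top ENNReal.ofReal_ne_top (hIt σ))
        (hTI _ _ σ.2.2.2)
      rw [ENNReal.toReal_mul, ENNReal.toReal_ofReal (by positivity)] at h
      exact h.trans (le_of_eq (by ring)))
    (fun σ s hs0 hs => by
      lift s to ℝ≥0 using hs0.le
      have hs' : s ≤ 1 / 2 := by rw [← NNReal.coe_le_coe]; push_cast; exact hs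
      have hs1 : s ≤ 1 := hs'.trans (by rw [← NNReal.coe_le_coe]; norm_num)
      obtain ⟨⟨g, ρ⟩, hg1, hg2, hρ⟩ := σ
      have hr : ∀ x, ∑' y, moveRate K s g x y ≤ 1 := fun x =>
        (tsum_moveRate_le K s g x).trans (by exact_mod_cast hs1)
      have hg0 : ∀ x, 0 < g x := fun x => lt_of_lt_of_le hε (hg1 x)
      have hρ' := bind_moveRate hrev hs1 hg0 hg2 hρ hr
      let σ' : S := ⟨(stepDensity K s g, ρ.bind (lazyKernel (moveRate K s g) hr)),
        le_stepDensity hs1 hg1 hg2, stepDensity_le hs1 hg2, hρ'⟩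
      have hE := entropySum_step_le hrev hs1 hε hg1 hg2
      have hW := weakCost_le_weakCost_step hirr hrev hC hs' hTI hg0 hg2 hρ hρ'
      have hW' := ENNReal.toReal_mono (ENNReal.add_ne_top.2 ⟨hWt σ', ENNReal.ofReal_ne_top⟩) hW
      rw [ENNReal.toReal_add (hWt σ') ENNReal.ofReal_ne_top,
        ENNReal.toReal_ofReal (by positivity)] at hW'
      have ha : (0 : ℝ) ≤ M ^ 2 / ε * s ^ 2 := by positivity
      have hb : (0 : ℝ) ≤ (8 / C + 2) * s ^ 2 := by positivity
      refine ⟨σ', ?_, ?_⟩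
      · simp only [add_mul] at hW' ha hb ⊢; linarith
      · simp only [add_mul] at hE ha hb ⊢; linarith) ⟨(f, ν), h1, h2, hν⟩
  rw [← ENNReal.ofReal_toReal (hWt ⟨(f, ν), h1, h2, hν⟩)]
  exact ENNReal.ofReal_le_ofReal main

/-! ### Approximation by clipped densities. -/

/-- `f` clipped to the interval `[1 / (n + 1), n + 1]`. -/
def clip (f : X → ℝ≥0) (n : ℕ) (x : X) : ℝ≥0 := max ((n : ℝ≥0) + 1)⁻¹ (min (f x) (n + 1))

theorem inv_le_clip (f : X → ℝ≥0) (n : ℕ) (x : X) : ((n : ℝ≥0) + 1)⁻¹ ≤ clip f n x :=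
  le_max_left _ _

theorem inv_natCast_add_one_le_one (n : ℕ) : ((n : ℝ≥0) + 1)⁻¹ ≤ 1 :=
  inv_le_one_of_one_le₀ le_add_self

theorem clip_le (f : X → ℝ≥0) (n : ℕ) (x : X) : clip f n x ≤ n + 1 :=
  max_le ((inv_natCast_add_one_le_one n).trans le_add_self) (min_le_right _ _)

theorem clip_le_add_one (f : X → ℝ≥0) (n : ℕ) (x : X) : clip f n x ≤ f x + 1 :=
  max_le ((inv_natCast_add_one_le_one n).trans le_add_self)
    ((min_le_left _ _).trans le_self_add)

open Filter Topology in
theorem tendsto_clip (f : X → ℝ≥0) (x : X) :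
    Tendsto (fun n => (clip f n x : ℝ)) atTop (𝓝 (f x)) := by
  rw [NNReal.tendsto_coe]
  have h1 : Tendsto (fun n : ℕ => ((n : ℝ≥0) + 1)⁻¹) atTop (𝓝 0) := by
    have h := tendsto_one_div_add_atTop_nhds_zero_nat (𝕜 := ℝ)
    rw [← NNReal.tendsto_coe]
    exact h.congr fun n => by push_cast; rw [one_div]
  have h2 : Tendsto (fun n : ℕ => min (f x) ((n : ℝ≥0) + 1)) atTop (𝓝 (f x)) := by
    refine tendsto_const_nhds.congr' ?_
    obtain ⟨m, hm⟩ := exists_nat_ge (f x)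
    filter_upwards [eventually_ge_atTop m] with n hn
    refine (min_eq_left (hm.trans ?_)).symm
    have : (m : ℝ≥0) ≤ n := by exact_mod_cast hn
    exact this.trans le_self_add
  simpa [clip] using h1.max h2

/-- Domination for the entropies: raising `f` to a level in `(0, 1]` gives `|t log t| < 1`, and
lowering it to a level `≥ 1` decreases `t log t`. -/
theorem abs_clip_mul_log_le (f : X → ℝ≥0) (n : ℕ) (x : X) :
    |(clip f n x : ℝ) * Real.log (clip f n x)| ≤ |(f x : ℝ) * Real.log (f x)| + 1 := by
  have hi : 0 < ((n : ℝ≥0) + 1)⁻¹ := by positivity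
  have hi1 := inv_natCast_add_one_le_one n
  have hn1 : (1 : ℝ≥0) ≤ n + 1 := le_add_self
  unfold clip
  rcases le_total (f x) (n + 1) with h | h
  · rw [min_eq_left h]
    rcases le_total (f x) ((n : ℝ≥0) + 1)⁻¹ with h' | h'
    · rw [max_eq_left h', mul_comm]
      have := Real.abs_log_mul_self_lt (((n : ℝ≥0) + 1)⁻¹ : ℝ≥0) hi hi1
      linarith [abs_nonneg ((f x : ℝ) * Real.log (f x))]
    · rw [max_eq_right h']; linarith
  · rw [min_eq_right h, max_eq_right (hi1.trans hn1)]
    have hn1' : (1 : ℝ) ≤ ((n + 1 : ℝ≥0) : ℝ) := hn1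
    have h' : ((n + 1 : ℝ≥0) : ℝ) ≤ f x := h
    have hl : 0 ≤ Real.log ((n + 1 : ℝ≥0) : ℝ) := Real.log_nonneg hn1'
    have hl' : Real.log ((n + 1 : ℝ≥0) : ℝ) ≤ Real.log (f x) :=
      Real.log_le_log (by linarith) h'
    rw [abs_of_nonneg (mul_nonneg (by linarith) hl)]
    have := mul_le_mul h' hl' hl (by linarith)
    linarith [le_abs_self ((f x : ℝ) * Real.log (f x))]

/-- The total mass of the clipped density. -/
def clipMass (π : PMF X) (f : X → ℝ≥0) (n : ℕ) : ℝ := ∑' x, (clip f n x : ℝ) * (π x).toReal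

theorem summable_clip (π : PMF X) (f : X → ℝ≥0) (n : ℕ) :
    Summable fun x => (clip f n x : ℝ) * (π x).toReal :=
  summable_mul_of_bounded (summable_pmf_toReal π) (fun _ => ENNReal.toReal_nonneg)
    (B := (n + 1 : ℝ≥0)) fun x => by rw [NNReal.abs_eq]; exact clip_le f n x

theorem clipMass_pos (π : PMF X) (f : X → ℝ≥0) (n : ℕ) : 0 < clipMass π f n := by
  have h : ((((n : ℝ≥0) + 1)⁻¹ : ℝ≥0) : ℝ) ≤ clipMass π f n := by
    rw [← mul_one ((((n : ℝ≥0) + 1)⁻¹ : ℝ≥0) : ℝ), ← tsum_pmf_toReal π, ← tsum_mul_left]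
    exact ((summable_pmf_toReal π).mul_left _).tsum_le_tsum
      (fun x => mul_le_mul_of_nonneg_right (inv_le_clip f n x) ENNReal.toReal_nonneg)
      (summable_clip π f n)
  have hi : (0 : ℝ) < (((n : ℝ≥0) + 1)⁻¹ : ℝ≥0) := by positivity
  exact lt_of_lt_of_le hi h

/-- The clipped density, normalised to be a probability density. -/
def clipDensity (π : PMF X) (f : X → ℝ≥0) (n : ℕ) (x : X) : ℝ≥0 :=
  clip f n x / (clipMass π f n).toNNReal

theorem coe_clipDensity (π : PMF X) (f : X → ℝ≥0) (n : ℕ) (x : X) :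
    (clipDensity π f n x : ℝ) = clip f n x / clipMass π f n := by
  unfold clipDensity
  rw [NNReal.coe_div, Real.coe_toNNReal _ (clipMass_pos π f n).le]

theorem hasSum_clipDensity (π : PMF X) (f : X → ℝ≥0) (n : ℕ) :
    HasSum (fun x => (clipDensity π f n x : ℝ≥0∞) * π x) 1 := by
  have h1 : HasSum (fun x => (clipDensity π f n x : ℝ) * (π x).toReal) 1 := by
    have := (summable_clip π f n).hasSum.div_const (clipMass π f n)
    rw [show (∑' x, (clip f n x : ℝ) * (π x).toReal) / clipMass π f n = 1 from
      div_self (clipMass_pos π f n).ne'] at this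
    refine this.congr_fun fun x => ?_
    rw [coe_clipDensity]; ring
  refine (Summable.hasSum_iff ENNReal.summable).2 ?_
  have ht : ∀ x, (clipDensity π f n x : ℝ≥0∞) * π x
      = ENNReal.ofReal ((clipDensity π f n x : ℝ) * (π x).toReal) := fun x => by
    rw [ENNReal.ofReal_mul (NNReal.coe_nonneg _), ENNReal.ofReal_coe_nnreal,
      ENNReal.ofReal_toReal (π.apply_ne_top x)]
  simp only [ht]
  rw [← ENNReal.ofReal_tsum_of_nonneg (fun x => by positivity) h1.summable, h1.tsum_eq,
    ENNReal.ofReal_one]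

/-- The probability measure whose density with respect to `π` is the normalised clipped density. -/
def clipPMF (π : PMF X) (f : X → ℝ≥0) (n : ℕ) : PMF X :=
  ⟨fun x => (clipDensity π f n x : ℝ≥0∞) * π x, hasSum_clipDensity π f n⟩

theorem clipPMF_apply (π : PMF X) (f : X → ℝ≥0) (n : ℕ) (x : X) :
    clipPMF π f n x = clipDensity π f n x * π x := rfl

open Filter Topology

theorem tendsto_clipMass {π ν : PMF X} {f : X → ℝ≥0} (hν : ∀ x, ν x = f x * π x) :
    Tendsto (clipMass π f) atTop (𝓝 1) := by
  rw [← tsum_density hν]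
  refine tendsto_tsum_of_dominated_convergence (bound := fun x => (f x : ℝ) * (π x).toReal
    + (π x).toReal) ((summable_density hν).add (summable_pmf_toReal π))
    (fun x => (tendsto_clip f x).mul_const _) (Eventually.of_forall fun n x => ?_)
  rw [Real.norm_of_nonneg (by positivity), ← add_one_mul]
  exact mul_le_mul_of_nonneg_right (clip_le_add_one f n x) ENNReal.toReal_nonneg

theorem tendsto_clipDensity {π ν : PMF X} {f : X → ℝ≥0} (hν : ∀ x, ν x = f x * π x) (x : X) :
    Tendsto (fun n => clipDensity π f n x) atTop (𝓝 (f x)) := by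
  rw [← NNReal.tendsto_coe]
  simp only [coe_clipDensity]
  have h := (tendsto_clip f x).div (tendsto_clipMass hν) one_ne_zero
  rw [div_one] at h
  exact h

theorem tendsto_clipPMF {π ν : PMF X} {f : X → ℝ≥0} (hν : ∀ x, ν x = f x * π x) (x : X) :
    Tendsto (fun n => clipPMF π f n x) atTop (𝓝 (ν x)) := by
  simp only [clipPMF_apply, hν]
  exact ENNReal.Tendsto.mul_const (ENNReal.tendsto_coe.2 (tendsto_clipDensity hν x))
    (Or.inr (π.apply_ne_top x))

theorem entropySum_clipDensity (π : PMF X) (f : X → ℝ≥0) (n : ℕ) :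
    entropySum π (clipDensity π f n) = (∑' x, (clip f n x : ℝ) * Real.log (clip f n x)
      * (π x).toReal) / clipMass π f n - Real.log (clipMass π f n) := by
  have hZ := clipMass_pos π f n
  have hi : 0 < ((n : ℝ≥0) + 1)⁻¹ := by positivity
  have hS := summable_entropy π hi (inv_le_clip f n) (clip_le f n)
  have hpt : ∀ x, (clipDensity π f n x : ℝ) * Real.log (clipDensity π f n x) * (π x).toReal
      = (clip f n x : ℝ) * Real.log (clip f n x) * (π x).toReal / clipMass π f n
        - (clip f n x : ℝ) * (π x).toReal * (Real.log (clipMass π f n) / clipMass π f n) := by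
    intro x
    have hpos : (0 : ℝ) < clip f n x := lt_of_lt_of_le hi (inv_le_clip f n x)
    rw [coe_clipDensity, Real.log_div hpos.ne' hZ.ne']
    ring
  unfold entropySum
  simp only [hpt]
  rw [(hS.div_const _).tsum_sub ((summable_clip π f n).mul_right _), tsum_div_const,
    tsum_mul_right]
  change _ - clipMass π f n * _ = _
  field_simp

theorem tendsto_entropySum_clipDensity {π ν : PMF X} {f : X → ℝ≥0} (hν : ∀ x, ν x = f x * π x)
    (hS : Summable fun x => (f x : ℝ) * Real.log (f x) * (π x).toReal) :
    Tendsto (fun n => entropySum π (clipDensity π f n)) atTop (𝓝 (entropySum π f)) := by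
  simp only [entropySum_clipDensity]
  have h1 : Tendsto (fun n => ∑' x, (clip f n x : ℝ) * Real.log (clip f n x) * (π x).toReal)
      atTop (𝓝 (entropySum π f)) := by
    refine tendsto_tsum_of_dominated_convergence (bound := fun x =>
      |(f x : ℝ) * Real.log (f x) * (π x).toReal| + (π x).toReal)
      (hS.abs.add (summable_pmf_toReal π)) (fun x => ?_) (Eventually.of_forall fun n x => ?_)
    · exact ((Real.continuous_mul_log.tendsto _).comp (tendsto_clip f x)).mul_const _
    · rw [Real.norm_eq_abs, abs_mul, abs_mul _ (π x).toReal, abs_of_nonneg ENNReal.toReal_nonneg,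
        ← add_one_mul]
      exact mul_le_mul_of_nonneg_right (abs_clip_mul_log_le f n x) ENNReal.toReal_nonneg
  have hZ := tendsto_clipMass hν
  simpa using (h1.div hZ one_ne_zero).sub (hZ.log one_ne_zero)

end WeakTransport

end

theorem theorem6p2 {X : Type*} [Countable X] (K : X → PMF X) (π : PMF X)
    (hirr : WeakTransport.IsIrreducible K) (hrev : WeakTransport.IsReversible K π)
    (C : ℝ) (hC : 0 < C) (hTI : WeakTransport.WeakTransportInformation K π C) :
    WeakTransport.WeakTransportEntropy K π C := by
  open WeakTransport in
  intro f ν hν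
  unfold relEntropy
  split_ifs with hS
  -- The density has mass one, so the correction term in `relEntropy` vanishes.
  · rw [tsum_density hν, Real.log_one, mul_zero, sub_zero, ← ENNReal.ofReal_mul (by positivity)]
    lift C to NNReal using hC.le
    refine weakCost_le_of_tendsto (graphDist K) (tendsto_clipPMF hν)
      (c := fun n => ENNReal.ofReal (2 / C * entropySum π (clipDensity π f n))) (fun n => ?_)
      (ENNReal.tendsto_ofReal ((tendsto_entropySum_clipDensity hν hS).const_mul _))
    have hZ : 0 < (clipMass π f n).toNNReal := Real.toNNReal_pos.2 (clipMass_pos π f n)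
    have hi : 0 < ((n : NNReal) + 1)⁻¹ := by positivity
    exact weakCost_le_of_bounded hirr hrev hC hTI
      (ε := ((n : NNReal) + 1)⁻¹ / (clipMass π f n).toNNReal)
      (M := (n + 1) / (clipMass π f n).toNNReal) (div_pos hi hZ)
      (fun x => by unfold clipDensity; gcongr; exact inv_le_clip f n x)
      (fun x => by unfold clipDensity; gcongr; exact clip_le f n x) (clipPMF_apply π f n)
  · rw [ENNReal.mul_top (by simpa using hC)]
    exact le_top
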